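/- Let $(\mathsf X,\mathcal X)$ and $(\mathsf Y,\mathcal Y)$ be measurable spaces, $Q$ a Markov kernel on $\mathsf X$, and $G$ a Markov kernel from $\mathsf X$ to $\mathsf Y$ with $G(x,\mathrm dy)=g(x,y)\,\nu(\mathrm dy)$ for a $\sigma$-finite measure $\nu$ and a measurable $g\ge 0$ on $\mathsf X\times\mathsf Y$. Let $(Y_k)_{k\in\mathbb N}$ be a strictly stationary $\mathsf Y$-valued sequence on a probability space $(\Omega,\mathcal A,\mathbb P)$ (not assumed to come from the model $(Q,G)$). For $y=(y_k)_{k\in\mathbb N}$ and $k\le m$ let $L\langle y_{k:m}\rangle(x_k,A)=\int\cdots\int \mathbf 1_A(x_{m+1})\prod_{\ell=k}^m g(x_\ell,y_\ell)\,Q(x_\ell,\mathrm dx_{\ell+1})$, and $L\langle y_{k:m}\rangle(x,\cdot)=\delta_x$ for $k>m$. For a probability measure $\chi$ on $\mathsf X$ let $\phi_\chi\langle y_{0:n-1}\rangle(A)=\chi L\langle y_{0:n-1}\rangle\mathbf 1_A/\chi L\langle y_{0:n-1}\rangle\mathbf 1_{\mathsf X}$ be the predictor, and for bounded measurable $h:\mathsf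 X\to\mathbb R$ let $\sigma_\chi\langle y_{0:n-1}\rangle(h)\ge 0$ be given by $$\sigma_\chi^2\langle y_{0:n-1}\rangle(h)=\sum_{k=0}^n \phi_\chi\langle y_{0:k-1}\rangle\left(\frac{L\langle y_{k:n-1}\rangle h-\phi_\chi\langle y_{0:n-1}\rangle h\cdot L\langle y_{k:n-1}\rangle\mathbf 1_{\mathsf X}}{\phi_\chi\langle y_{0:k-1}\rangle L\langle y_{k:n-1}\rangle\mathbf 1_{\mathsf X}}\right)^2 .$$ For each $N\ge 1$ let $(\xi_n^{N,i})_{n\in\mathbb N,\,1\le i\le N}$ be the particles of a bootstrap particle filter run on $(Y_k)$: given $(Y_k)_{k\in\mathbb N}$, the $\xi_0^{N,i}$ are i.i.d. with law $\chi$; given $(Y_k)_{k\in\mathbb N}$ and all particles up to time $n$, the $\xi_{n+1}^{N,i}$, $1\le i\le N$, are i.i.d. with law $\sum_{j=1}^N \frac{g(\xi_n^{N,j},Y_n)}{\sum_{\ell=1}^N g(\xi_n^{N,\ell},Y_n)}\,Q(\xi_n^{N,j},\cdot)$. Write $\phi^N_\chi\langle Y_{0:n-1}\rangle h=\frac1N\sum_{i=1}^N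 h(\xi_n^{N,i})$. Theorem. Assume (A2): $g(x,y)>0$ for all $(x,y)\in\mathsf X\times\mathsf Y$, and $\mathbb E\big[\ln^+\sup_{x\in\mathsf X} g(x,Y_0)\big]<\infty$. Then for every bounded measurable $h:\mathsf X\to\mathbb R$, every $p>0$, every probability measure $\chi$ on $\mathsf X$ and every $n\in\mathbb N$, $\mathbb P$-almost surely, $$\lim_{N\to\infty}\sqrt N\;\mathbb E\Big[\big|\phi_\chi^N\langle Y_{0:n-1}\rangle h-\phi_\chi\langle Y_{0:n-1}\rangle h\big|^p\,\Big|\,Y_{0:n-1}\Big]^{1/p}=\sqrt2\,\sigma_\chi\langle Y_{0:n-1}\rangle(h)\left(\frac{\Gamma((p+1)/2)}{\sqrt{\pi}}\right)^{1/p},$$ where $\Gamma$ is the gamma function. The right-hand side equals $\big(\int_{\mathbb R}|\sigma_\chi\langle Y_{0:n-1}\rangle(h)\,z|^p\,\gamma(\mathrm dz)\big)^{1/p}$ with $\gamma$ the standard normal law, that is, the $L^p$ norm of the centred normal distribution with standard deviation $\sigma_\chi\langle Y_{0:n-1}\rangle(h)$. -/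

import Mathlib

open MeasureTheory ProbabilityTheory Filter Topology
open scoped ENNReal

noncomputable section

/-- A hidden Markov model with state space `X` and observation space `Y`: a Markov transition
kernel `Q` on `X` and a Markov observation kernel `G` from `X` to `Y`, where `G` has the
transition density `g` with respect to a `σ`-finite measure `ν` on `Y`. -/
structure HMM (X Y : Type*) [MeasurableSpace X] [MeasurableSpace Y] where
  Q : Kernel X X
  G : Kernel X Y
  ν : Measure Y
  g : X → Y → ℝ
  markovQ : IsMarkovKernel Q
  markovG : IsMarkovKernel G
  sigmaFinite_ν : SigmaFinite ν
  measurable_g : Measurable (Function.uncurry g)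
  g_nonneg : ∀ x y, 0 ≤ g x y
  G_eq : ∀ x, G x = ν.withDensity (fun y => ENNReal.ofReal (g x y))

attribute [instance] HMM.markovQ HMM.markovG HMM.sigmaFinite_ν

namespace HMM

variable {X Y : Type*} [MeasurableSpace X] [MeasurableSpace Y] (M : HMM X Y)

/-- The supremum norm of the local likelihood `x ↦ g x y`, with values in `[0, ∞]`. -/
def likSup (y : Y) : ℝ≥0∞ := ⨆ x, ENNReal.ofReal (M.g x y)

/-- The one-step unnormalized kernel `(x, A) ↦ g(x, y) Q(x, A)`. -/
def step (y : Y) : Kernel X X :=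
  M.Q.withDensity (fun x _ => ENNReal.ofReal (M.g x y))

/-- `M.L y k m` is the unnormalized kernel associated with the `m` observations
`y k, …, y (k + m - 1)`: starting from `x_k`, it integrates out `x_{k+1}, …, x_{k+m-1}` in
`∏_{ℓ = k}^{k+m-1} g(x_ℓ, y_ℓ) Q(x_ℓ, dx_{ℓ+1})`. It is `δ_x` when `m = 0`. -/
def L (y : ℕ → Y) (k : ℕ) : ℕ → Kernel X X
  | 0 => Kernel.id
  | m + 1 => M.step (y (k + m)) ∘ₖ L y k m

/-- The predictor of the state at time `n` given the observations `y 0, …, y (n - 1)`, for the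
initial law `χ`: the normalization of `χ L`. -/
def predictor (χ : Measure X) (y : ℕ → Y) (n : ℕ) : Measure X :=
  ((M.L y 0 n ∘ₘ χ) Set.univ)⁻¹ • (M.L y 0 n ∘ₘ χ)

/-- The asymptotic variance `σ_χ²⟨y_{0:n-1}⟩(h)` of the particle predictor. -/
def asympVar (χ : Measure X) (y : ℕ → Y) (n : ℕ) (h : X → ℝ) : ℝ :=
  ∑ k ∈ Finset.range (n + 1),
    ∫ x, ((∫ z, h z ∂(M.L y k (n - k) x)
            - (∫ z, h z ∂(M.predictor χ y n)) * ∫ _z, (1 : ℝ) ∂(M.L y k (n - k) x))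
          / ∫ x', (∫ _z, (1 : ℝ) ∂(M.L y k (n - k) x')) ∂(M.predictor χ y k)) ^ 2
      ∂(M.predictor χ y k)

/-- The asymptotic standard deviation `σ_χ⟨y_{0:n-1}⟩(h)`. -/
def asympStd (χ : Measure X) (y : ℕ → Y) (n : ℕ) (h : X → ℝ) : ℝ :=
  √(M.asympVar χ y n h)

/-- The mixture `∑ j, (ω^j / ∑ ℓ, ω^ℓ) Q(x^j, ·)` with the importance weights `ω^j = g(x^j, y)`,
from which the particles of the next generation are drawn. -/
def mixture (y : Y) {N : ℕ} (x : Fin N → X) : Measure X :=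
  ∑ j, ENNReal.ofReal (M.g (x j) y / ∑ l, M.g (x l) y) • M.Q (x j)

/-- The likelihood is positive and `E[log⁺ ‖g_{Y₀}‖_∞] < ∞`. (`EReal.toENNReal` sends negative
values to `0`, so it turns the extended logarithm into its positive part.) -/
structure LikelihoodCondition {Ω : Type*} [MeasurableSpace Ω] (P : Measure Ω)
    (Yobs : ℕ → Ω → Y) : Prop where
  g_pos : ∀ x y, 0 < M.g x y
  aemeasurable_likSup : AEMeasurable M.likSup (P.map (Yobs 0))
  integrable_log : ∫⁻ ω, (ENNReal.log (M.likSup (Yobs 0 ω))).toENNReal ∂P < ∞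

/-- `ξ n i`, `n ∈ ℕ`, `i = 1, …, N`, are the particles of a bootstrap particle filter with `N`
particles and initial law `χ`, run on the observation sequence `Yobs`: given all the
observations, the initial particles are i.i.d. with law `χ`; given all the observations and the
particles up to time `n`, the particles at time `n + 1` are i.i.d. draws from the mixture of the
kernels `Q(ξ n j, ·)` with weights proportional to `g(ξ n j, Y_n)`. -/
structure IsBootstrapFilter (χ : Measure X) {Ω : Type*} [MeasurableSpace Ω] (P : Measure Ω)
    (Yobs : ℕ → Ω → Y) (N : ℕ) (ξ : ℕ → Fin N → Ω → X) : Prop where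
  measurable : ∀ n i, Measurable (ξ n i)
  init : ∀ A : Fin N → Set X, (∀ i, MeasurableSet (A i)) →
    P⟦{ω | ∀ i, ξ 0 i ω ∈ A i} | MeasurableSpace.comap (fun ω k => Yobs k ω) inferInstance⟧
      =ᵐ[P] fun _ => ∏ i, χ.real (A i)
  next : ∀ n, ∀ A : Fin N → Set X, (∀ i, MeasurableSet (A i)) →
    P⟦{ω | ∀ i, ξ (n + 1) i ω ∈ A i} |
        MeasurableSpace.comap (fun ω k => Yobs k ω) inferInstance ⊔
        MeasurableSpace.comap (fun ω (k : Fin (n + 1)) i => ξ k i ω) inferInstance⟧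
      =ᵐ[P] fun ω => ∏ i, (M.mixture (Yobs n ω) (fun j => ξ n j ω)).real (A i)

end HMM

/-- Strict stationarity of a process indexed by `ℕ`. -/
def IsStationarySeq {Ω Y : Type*} [MeasurableSpace Ω] [MeasurableSpace Y] (P : Measure Ω)
    (Yobs : ℕ → Ω → Y) : Prop :=
  P.map (fun ω k => Yobs (k + 1) ω) = P.map (fun ω k => Yobs k ω)

/-- The integral of `h` under the empirical measure of the sample `x`. -/
def empMean {X : Type*} (h : X → ℝ) {N : ℕ} (x : Fin N → X) : ℝ := (∑ i, h (x i)) / N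

end

/-! Freeze an observation sequence along which every likelihood `g(·, y_k)` is bounded; the
logarithmic moment and stationarity serve only to make this almost sure. Given the observations, the
particles at time `n` have law `particleKernel`, so the conditional expectation is an ordinary
integral (`condExp_obs_particles_ae_eq`), and what remains is a central limit theorem with
convergence of moments for a fixed `y`.

The central limit theorem goes by induction on `n`, for all bounded `h` at once. Given the particles
at time `n`, the next ones are i.i.d. from the mixture, so the scaled error at time `n + 1` is an
i.i.d. fluctuation around the mixture mean plus `√N` times the bias of that mean. The bias is a
self-normalized ratio. By `sqrt_mul_mixBias`, `√N` times it is the scaled error at time `n` of the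
centred function `pullback h`, up to a product of two errors, which is `O(N^{-1/2})` in mean. The
i.i.d. part has a random law that changes with `N`, hence the need for a bound uniform over the law:
`norm_integral_cexp_scaledError_sub_le`. Together they give, up to `O(N^{-1/2})`, that the
characteristic function for `h` at time `n + 1` is the one for `pullback h` at time `n` times
`exp(-v/2)`, with `v` the variance of `h` under the predictor at time `n + 1`. The asymptotic
variance satisfies the matching recursion `asympVar_succ`.

To pass from weak convergence to moments, Hoeffding's lemma and the same decomposition bound the
exponential moments of the scaled errors uniformly in `N`. These also control the remainders above.
The limit is then an explicit Gaussian absolute moment. -/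

noncomputable section

/-! ### The law of the particles for a fixed observation sequence. -/

/-- Product measures of a measurable family of probability measures form a measurable family. -/
lemma measurable_measure_pi_const {α X ι : Type*} [MeasurableSpace α] [MeasurableSpace X] [Fintype ι]
    {μ : α → Measure X} [∀ a, IsProbabilityMeasure (μ a)] (hμ : Measurable μ) :
    Measurable fun a => Measure.pi fun _ : ι => μ a := by
  refine Measurable.measure_of_isPiSystem_of_isProbabilityMeasure
    generateFrom_pi.symm isPiSystem_pi ?_
  rintro _ ⟨A, hA, rfl⟩
  simp only [Measure.pi_pi]
  refine Finset.measurable_prod _ fun i _ => ?_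
  exact (Measure.measurable_coe (hA i (Set.mem_univ i))).comp hμ

namespace HMM

variable {X Y : Type*} [MeasurableSpace X] [MeasurableSpace Y] (M : HMM X Y)

lemma sum_g_pos (hg : ∀ x y, 0 < M.g x y) (y : Y) {N : ℕ} [NeZero N] (x : Fin N → X) :
    0 < ∑ l, M.g (x l) y :=
  Finset.sum_pos (fun _ _ => hg _ _) Finset.univ_nonempty

lemma isProbabilityMeasure_mixture (hg : ∀ x y, 0 < M.g x y) (y : Y) {N : ℕ} [NeZero N]
    (x : Fin N → X) : IsProbabilityMeasure (M.mixture y x) := by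
  have hs := M.sum_g_pos hg y x
  constructor
  simp only [mixture, Measure.coe_finsetSum, Finset.sum_apply, Measure.smul_apply, measure_univ,
    smul_eq_mul, mul_one]
  rw [← ENNReal.ofReal_sum_of_nonneg fun i _ => div_nonneg (hg _ _).le hs.le, ← Finset.sum_div,
    div_self hs.ne', ENNReal.ofReal_one]

lemma measurable_g_left (y : Y) : Measurable fun x => M.g x y :=
  M.measurable_g.comp (by fun_prop : Measurable fun x => (x, y))

lemma measurable_g_comp {α : Type*} [MeasurableSpace α] {u : α → X} {v : α → Y}
    (hu : Measurable u) (hv : Measurable v) : Measurable fun a => M.g (u a) (v a) :=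
  M.measurable_g.comp (hu.prodMk hv)

lemma measurable_mixture (N : ℕ) :
    Measurable fun p : Y × (Fin N → X) => M.mixture p.1 p.2 := by
  refine Measure.measurable_of_measurable_coe _ fun A hA => ?_
  simp only [mixture, Measure.coe_finsetSum, Finset.sum_apply, Measure.smul_apply, smul_eq_mul]
  refine Finset.measurable_sum _ fun j _ => ?_
  refine Measurable.mul (ENNReal.measurable_ofReal.comp ?_) ?_
  · exact (M.measurable_g_comp (by fun_prop) measurable_fst).div
      (Finset.measurable_sum _ fun l _ => M.measurable_g_comp (by fun_prop) measurable_fst)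
  · exact (Kernel.measurable_coe M.Q hA).comp (by fun_prop)

/-- One step of the particle system: given the observation `y` and the particles `x`, draw the new
particles independently from the mixture. -/
def mutation (hg : ∀ x y, 0 < M.g x y) (N : ℕ) [NeZero N] :
    Kernel (Y × (Fin N → X)) (Fin N → X) where
  toFun p := Measure.pi fun _ => M.mixture p.1 p.2
  measurable' :=
    haveI := fun p : Y × (Fin N → X) => M.isProbabilityMeasure_mixture hg p.1 p.2
    measurable_measure_pi_const (M.measurable_mixture N)

lemma mutation_apply (hg : ∀ x y, 0 < M.g x y) (N : ℕ) [NeZero N] (p : Y × (Fin N → X)) :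
    M.mutation hg N p = Measure.pi fun _ => M.mixture p.1 p.2 := rfl

instance (hg : ∀ x y, 0 < M.g x y) (N : ℕ) [NeZero N] : IsMarkovKernel (M.mutation hg N) where
  isProbabilityMeasure p := by
    have := M.isProbabilityMeasure_mixture hg p.1 p.2
    rw [mutation_apply]
    infer_instance

/-- The law of the particles at time `n` given the observations. -/
def particleKernel (hg : ∀ x y, 0 < M.g x y) (χ : Measure X) (N : ℕ) [NeZero N] :
    ℕ → Kernel (ℕ → Y) (Fin N → X)
  | 0 => Kernel.const _ (Measure.pi fun _ => χ)
  | n + 1 => Kernel.snd (particleKernel hg χ N n ⊗ₖ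
      (M.mutation hg N).comap (fun p : (ℕ → Y) × (Fin N → X) => (p.1 n, p.2)) (by fun_prop))

variable (hg : ∀ x y, 0 < M.g x y) (χ : Measure X) [IsProbabilityMeasure χ] (N : ℕ) [NeZero N]

instance (n : ℕ) : IsMarkovKernel (M.particleKernel hg χ N n) := by
  induction n with
  | zero => rw [particleKernel]; infer_instance
  | succ n ih => rw [particleKernel]; infer_instance

omit [IsProbabilityMeasure χ] in
lemma particleKernel_zero_apply (y : ℕ → Y) :
    M.particleKernel hg χ N 0 y = Measure.pi fun _ => χ := rfl

lemma lintegral_particleKernel_succ (n : ℕ) (y : ℕ → Y) {f : (Fin N → X) → ℝ≥0∞}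
    (hf : Measurable f) :
    ∫⁻ x, f x ∂(M.particleKernel hg χ N (n + 1) y) =
      ∫⁻ x, ∫⁻ x', f x' ∂(Measure.pi fun _ => M.mixture (y n) x)
        ∂(M.particleKernel hg χ N n y) := by
  rw [particleKernel, Kernel.lintegral_snd _ _ hf]
  exact Kernel.lintegral_compProd _ _ _ (hf.comp measurable_snd)

lemma integral_particleKernel_succ {E : Type*} [NormedAddCommGroup E] [NormedSpace ℝ E] (n : ℕ)
    (y : ℕ → Y) {f : (Fin N → X) → E} (hf : Integrable f (M.particleKernel hg χ N (n + 1) y)) :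
    ∫ x, f x ∂(M.particleKernel hg χ N (n + 1) y) =
      ∫ x, ∫ x', f x' ∂(Measure.pi fun _ => M.mixture (y n) x)
        ∂(M.particleKernel hg χ N n y) := by
  have h1 := hf
  rw [particleKernel, Kernel.snd_apply] at h1 ⊢
  rw [integral_map measurable_snd.aemeasurable h1.aestronglyMeasurable]
  exact ProbabilityTheory.integral_compProd ((integrable_map_measure h1.aestronglyMeasurable
    measurable_snd.aemeasurable).1 h1)

/-- The law of the particles at time `n` depends on the first `n` observations only. -/
lemma particleKernel_congr (n : ℕ) {y y' : ℕ → Y} (hy : ∀ k < n, y k = y' k) :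
    M.particleKernel hg χ N n y = M.particleKernel hg χ N n y' := by
  induction n with
  | zero => rfl
  | succ n ih =>
    ext A hA
    have hf : Measurable (A.indicator fun _ : Fin N → X => (1 : ℝ≥0∞)) :=
      measurable_const.indicator hA
    rw [← lintegral_indicator_one hA, ← lintegral_indicator_one hA]
    erw [lintegral_particleKernel_succ M hg χ N n y hf,
      lintegral_particleKernel_succ M hg χ N n y' hf]
    rw [ih fun k hk => hy k (by omega), hy n (by omega)]

end HMM

/-! ### Bounded test functions. -/

/-- Bounded measurable real functions. -/
structure BddMeas {X : Type*} [MeasurableSpace X] (h : X → ℝ) : Prop where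
  measurable : Measurable h
  bdd : ∃ C, ∀ x, |h x| ≤ C

namespace BddMeas

variable {X : Type*} [MeasurableSpace X] {f h : X → ℝ}

lemma exists_bound (hh : BddMeas h) : ∃ C, 0 ≤ C ∧ ∀ x, |h x| ≤ C := by
  obtain ⟨C, hC⟩ := hh.bdd
  exact ⟨|C|, abs_nonneg _, fun x => (hC x).trans (le_abs_self C)⟩

lemma integrable (hh : BddMeas h) (μ : Measure X) [IsFiniteMeasure μ] : Integrable h μ := by
  obtain ⟨C, hC⟩ := hh.bdd
  exact Integrable.of_bound hh.measurable.aestronglyMeasurable C (ae_of_all _ hC)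

lemma const (c : ℝ) : BddMeas fun _ : X => c := ⟨measurable_const, |c|, fun _ => le_rfl⟩

lemma mul (hf : BddMeas f) (hh : BddMeas h) : BddMeas fun x => f x * h x := by
  obtain ⟨C, hC0, hC⟩ := hf.exists_bound
  obtain ⟨D, -, hD⟩ := hh.exists_bound
  refine ⟨hf.measurable.mul hh.measurable, C * D, fun x => ?_⟩
  rw [abs_mul]
  exact mul_le_mul (hC x) (hD x) (abs_nonneg _) hC0

lemma sub (hf : BddMeas f) (hh : BddMeas h) : BddMeas fun x => f x - h x := by
  obtain ⟨C, hC⟩ := hf.bdd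
  obtain ⟨D, hD⟩ := hh.bdd
  exact ⟨hf.measurable.sub hh.measurable, C + D,
    fun x => (abs_sub _ _).trans (add_le_add (hC x) (hD x))⟩

lemma div_const (hf : BddMeas f) (c : ℝ) : BddMeas fun x => f x / c := by
  simpa only [div_eq_mul_inv] using hf.mul (BddMeas.const c⁻¹)

lemma kernel_integral {Z : Type*} [MeasurableSpace Z] (hf : BddMeas f) (κ : Kernel Z X)
    [IsFiniteKernel κ] : BddMeas fun z => ∫ x, f x ∂(κ z) := by
  obtain ⟨C, hC0, hC⟩ := hf.exists_bound
  refine ⟨(hf.measurable.stronglyMeasurable.integral_kernel (κ := κ)).measurable,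
    C * κ.bound.toReal, fun z => ?_⟩
  refine (norm_integral_le_of_norm_le_const (μ := κ z) (f := f) (ae_of_all _ hC)).trans ?_
  refine mul_le_mul_of_nonneg_left ?_ hC0
  exact ENNReal.toReal_mono κ.bound_ne_top (Kernel.measure_le_bound _ _ _)

end BddMeas

/-! ### Recursions for the predictor and for the asymptotic variance. -/

namespace HMM

variable {X Y : Type*} [MeasurableSpace X] [MeasurableSpace Y] (M : HMM X Y)

lemma step_apply (y : Y) (x : X) : M.step y x = ENNReal.ofReal (M.g x y) • M.Q x := by
  rw [step, Kernel.withDensity_apply _ (by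
    exact ENNReal.measurable_ofReal.comp (M.measurable_g_comp measurable_fst measurable_const)),
    withDensity_const]

lemma integral_step (y : Y) (x : X) (f : X → ℝ) :
    ∫ z, f z ∂(M.step y x) = M.g x y * ∫ z, f z ∂(M.Q x) := by
  rw [step_apply, integral_smul_measure, ENNReal.toReal_ofReal (M.g_nonneg x y), smul_eq_mul]

lemma bddMeas_g {y : Y} (hb : ∃ B, ∀ x, M.g x y ≤ B) : BddMeas fun x => M.g x y := by
  obtain ⟨B, hB⟩ := hb
  exact ⟨M.measurable_g_left y, B, fun x => by rw [abs_of_nonneg (M.g_nonneg x y)]; exact hB x⟩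

lemma isFiniteKernel_step {y : Y} (hb : ∃ B, ∀ x, M.g x y ≤ B) : IsFiniteKernel (M.step y) := by
  obtain ⟨B, hB⟩ := hb
  refine ⟨⟨ENNReal.ofReal B, ENNReal.ofReal_lt_top, fun x => ?_⟩⟩
  rw [step_apply, Measure.smul_apply, measure_univ, smul_eq_mul, mul_one]
  exact ENNReal.ofReal_le_ofReal (hB x)

section Predictor

variable {y : ℕ → Y} (hb : ∀ k, ∃ B, ∀ x, M.g x (y k) ≤ B)

include hb in
lemma isFiniteKernel_L (k m : ℕ) : IsFiniteKernel (M.L y k m) := by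
  induction m with
  | zero => rw [L]; infer_instance
  | succ m ih =>
    have := M.isFiniteKernel_step (hb (k + m))
    rw [L]; infer_instance

include hb in
lemma integral_L_succ (k m : ℕ) (x : X) {f : X → ℝ} (hf : BddMeas f) :
    ∫ z, f z ∂(M.L y k (m + 1) x)
      = ∫ z, M.g z (y (k + m)) * ∫ w, f w ∂(M.Q z) ∂(M.L y k m x) := by
  have := M.isFiniteKernel_L hb k (m + 1)
  have hi := hf.integrable (M.L y k (m + 1) x)
  rw [L] at hi ⊢
  rw [Kernel.integral_comp hi]
  simp_rw [integral_step]

lemma L_zero (k : ℕ) : M.L y k 0 = Kernel.id := rfl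

variable (χ : Measure X)

lemma L_comp_succ (n : ℕ) :
    M.L y 0 (n + 1) ∘ₘ χ = M.step (y n) ∘ₘ (M.L y 0 n ∘ₘ χ) := by
  rw [Measure.comp_assoc, L, zero_add]

lemma predictor_zero [IsProbabilityMeasure χ] : M.predictor χ y 0 = χ := by
  simp [predictor, L_zero]

include hb in
lemma isFiniteMeasure_L_comp [IsProbabilityMeasure χ] (n : ℕ) :
    IsFiniteMeasure (M.L y 0 n ∘ₘ χ) := by
  have := M.isFiniteKernel_L hb 0 n
  infer_instance

variable (hg : ∀ x y, 0 < M.g x y)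

-- Each step integrates a strictly positive likelihood against a measure that is nonzero by
-- induction.
include hg in
lemma L_comp_univ_ne_zero [IsProbabilityMeasure χ] (n : ℕ) :
    (M.L y 0 n ∘ₘ χ) Set.univ ≠ 0 := by
  induction n with
  | zero => simp [L_zero]
  | succ n ih =>
    rw [L_comp_succ, Measure.bind_apply MeasurableSet.univ (Kernel.aemeasurable _)]
    simp only [step_apply, Measure.smul_apply, measure_univ, smul_eq_mul, mul_one]
    refine ((lintegral_pos_iff_support (ENNReal.measurable_ofReal.comp
      (M.measurable_g_left (y n)))).2 ?_).ne'
    have : Function.support (fun a => ENNReal.ofReal (M.g a (y n))) = Set.univ := by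
      ext x
      simp [hg x (y n)]
    exact (pos_iff_ne_zero.2 (by simpa [Function.comp_def, this] using ih))

variable [IsProbabilityMeasure χ]

include hb hg in
lemma isProbabilityMeasure_predictor (n : ℕ) : IsProbabilityMeasure (M.predictor χ y n) := by
  have := M.isFiniteMeasure_L_comp hb χ n
  constructor
  rw [predictor, Measure.smul_apply, smul_eq_mul,
    ENNReal.inv_mul_cancel (M.L_comp_univ_ne_zero χ hg n) (measure_ne_top _ _)]

omit [IsProbabilityMeasure χ] in
lemma integral_predictor (n : ℕ) (f : X → ℝ) :
    ∫ x, f x ∂(M.predictor χ y n)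
      = (∫ x, f x ∂(M.L y 0 n ∘ₘ χ)) / ∫ _x, (1 : ℝ) ∂(M.L y 0 n ∘ₘ χ) := by
  rw [predictor, integral_smul_measure, smul_eq_mul, ENNReal.toReal_inv, integral_const, smul_eq_mul,
    mul_one, measureReal_def, div_eq_inv_mul]

include hb in
lemma integral_L_comp_succ (n : ℕ) {f : X → ℝ} (hf : BddMeas f) :
    ∫ x, f x ∂(M.L y 0 (n + 1) ∘ₘ χ)
      = ∫ x, M.g x (y n) * ∫ z, f z ∂(M.Q x) ∂(M.L y 0 n ∘ₘ χ) := by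
  have := M.isFiniteMeasure_L_comp hb χ (n + 1)
  have hi := hf.integrable (M.L y 0 (n + 1) ∘ₘ χ)
  rw [L_comp_succ, Measure.comp_eq_comp_const_apply] at hi ⊢
  rw [Kernel.integral_comp hi]
  simp_rw [integral_step, Kernel.const_apply]

include hb hg in
lemma integral_one_L_comp_pos (n : ℕ) : 0 < ∫ _x, (1 : ℝ) ∂(M.L y 0 n ∘ₘ χ) := by
  have := M.isFiniteMeasure_L_comp hb χ n
  rw [integral_const, smul_eq_mul, mul_one, measureReal_def]
  exact ENNReal.toReal_pos (M.L_comp_univ_ne_zero χ hg n) (measure_ne_top _ _)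

-- The integral is the ratio of the total masses of the unnormalized predictors at times `n + 1` and
-- `n`.
include hb hg in
lemma integral_g_predictor_pos (n : ℕ) : 0 < ∫ x, M.g x (y n) ∂(M.predictor χ y n) := by
  have h1 := M.integral_L_comp_succ hb χ n (BddMeas.const 1)
  simp only [integral_const, smul_eq_mul, mul_one, probReal_univ] at h1
  have h2 := M.integral_one_L_comp_pos hb χ hg (n + 1)
  simp only [integral_const, smul_eq_mul, mul_one] at h2
  rw [M.integral_predictor χ, ← h1]
  exact div_pos h2 (M.integral_one_L_comp_pos hb χ hg n)

include hb hg in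
/-- The predictor recursion. -/
lemma integral_predictor_succ (n : ℕ) {f : X → ℝ} (hf : BddMeas f) :
    ∫ x, f x ∂(M.predictor χ y (n + 1))
      = (∫ x, M.g x (y n) * ∫ z, f z ∂(M.Q x) ∂(M.predictor χ y n))
        / ∫ x, M.g x (y n) ∂(M.predictor χ y n) := by
  have h1 := M.integral_L_comp_succ hb χ n (BddMeas.const 1)
  simp only [integral_const, smul_eq_mul, mul_one, probReal_univ] at h1
  have h2 := (M.integral_one_L_comp_pos hb χ hg n).ne'
  rw [M.integral_predictor χ (n + 1), M.integral_predictor χ n,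
    M.integral_predictor χ n, M.integral_L_comp_succ hb χ n hf]
  rw [div_div_div_cancel_right₀ h2]
  simp only [integral_const, smul_eq_mul, mul_one, h1]

include hb hg in
/-- The predictor at time `k + m` is obtained from the predictor at time `k` by normalizing. -/
lemma integral_predictor_mul (k m : ℕ) {f : X → ℝ} (hf : BddMeas f) :
    (∫ x, f x ∂(M.predictor χ y (k + m))) *
        ∫ x, (∫ _z, (1 : ℝ) ∂(M.L y k m x)) ∂(M.predictor χ y k)
      = ∫ x, (∫ z, f z ∂(M.L y k m x)) ∂(M.predictor χ y k) := by
  have hp := M.isProbabilityMeasure_predictor hb χ hg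
  induction m generalizing f with
  | zero =>
    have h1 (f : X → ℝ) (hf : BddMeas f) (x : X) : ∫ z, f z ∂(M.L y k 0 x) = f x := by
      rw [L_zero, Kernel.id_apply, integral_dirac' _ _ hf.measurable.stronglyMeasurable]
    simp_rw [h1 f hf, h1 _ (BddMeas.const 1)]
    simp
  | succ m ih =>
    have hgb := M.bddMeas_g (hb (k + m))
    have hG := M.integral_g_predictor_pos hb χ hg (k + m)
    simp_rw [M.integral_L_succ hb k m _ hf, M.integral_L_succ hb k m _ (BddMeas.const 1)]
    rw [← ih (hgb.mul (hf.kernel_integral M.Q)), ← ih (hgb.mul ((BddMeas.const 1).kernel_integral M.Q)),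
      ← add_assoc, M.integral_predictor_succ hb χ hg (k + m) hf]
    simp only [integral_const, smul_eq_mul, mul_one, probReal_univ]
    field_simp

/-- The test function through which the fluctuations of the particles at time `n` contribute to
those of `h` at time `n + 1`. -/
def pullback (χ : Measure X) (y : ℕ → Y) (n : ℕ) (h : X → ℝ) (x : X) : ℝ :=
  M.g x (y n) * (∫ z, h z ∂(M.Q x) - ∫ z, h z ∂(M.predictor χ y (n + 1)))
    / ∫ z, M.g z (y n) ∂(M.predictor χ y n)

omit [IsProbabilityMeasure χ] in
include hb in
lemma bddMeas_pullback (n : ℕ) {h : X → ℝ} (hh : BddMeas h) : BddMeas (M.pullback χ y n h) :=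
  ((M.bddMeas_g (hb n)).mul ((hh.kernel_integral M.Q).sub (BddMeas.const _))).div_const _

-- This is the predictor recursion rearranged. Because of it, no centring term appears in the scaled
-- error or in the asymptotic variance of `pullback`.
include hb hg in
lemma integral_pullback (n : ℕ) {h : X → ℝ} (hh : BddMeas h) :
    ∫ x, M.pullback χ y n h x ∂(M.predictor χ y n) = 0 := by
  have := M.isProbabilityMeasure_predictor hb χ hg n
  have hgb := M.bddMeas_g (hb n)
  have hG := M.integral_g_predictor_pos hb χ hg n
  simp only [pullback, integral_div, mul_sub]
  rw [integral_sub ((hgb.mul (hh.kernel_integral M.Q)).integrable _)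
    ((hgb.mul (BddMeas.const _)).integrable _), integral_mul_const,
    M.integral_predictor_succ hb χ hg n hh]
  field_simp
  simp

omit [IsProbabilityMeasure χ] in
lemma asympVar_nonneg (n : ℕ) (h : X → ℝ) : 0 ≤ M.asympVar χ y n h :=
  Finset.sum_nonneg fun _ _ => integral_nonneg fun _ => sq_nonneg _

omit [IsProbabilityMeasure χ] in
lemma asympVar_top_term (n : ℕ) {h : X → ℝ} (hh : BddMeas h)
    [IsProbabilityMeasure (M.predictor χ y n)] :
    ∫ x, ((∫ z, h z ∂(M.L y n (n - n) x)
            - (∫ z, h z ∂(M.predictor χ y n)) * ∫ _z, (1 : ℝ) ∂(M.L y n (n - n) x))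
          / ∫ x', (∫ _z, (1 : ℝ) ∂(M.L y n (n - n) x')) ∂(M.predictor χ y n)) ^ 2
      ∂(M.predictor χ y n)
    = ∫ x, (h x - ∫ z, h z ∂(M.predictor χ y n)) ^ 2 ∂(M.predictor χ y n) := by
  have h1 (f : X → ℝ) (hf : BddMeas f) (x : X) : ∫ z, f z ∂(M.L y n 0 x) = f x := by
    rw [L_zero, Kernel.id_apply, integral_dirac' _ _ hf.measurable.stronglyMeasurable]
  rw [Nat.sub_self]
  simp_rw [h1 h hh, h1 _ (BddMeas.const 1)]
  simp

lemma asympVar_zero {h : X → ℝ} (hh : BddMeas h) :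
    M.asympVar χ y 0 h = ∫ x, (h x - ∫ z, h z ∂χ) ^ 2 ∂χ := by
  have : IsProbabilityMeasure (M.predictor χ y 0) := by rw [predictor_zero]; infer_instance
  rw [asympVar, Finset.sum_range_one, M.asympVar_top_term χ 0 hh, predictor_zero]

include hb hg in
/-- The recursion for the asymptotic variance. -/
lemma asympVar_succ (n : ℕ) {h : X → ℝ} (hh : BddMeas h) :
    M.asympVar χ y (n + 1) h =
      M.asympVar χ y n (M.pullback χ y n h)
        + ∫ x, (h x - ∫ z, h z ∂(M.predictor χ y (n + 1))) ^ 2 ∂(M.predictor χ y (n + 1)) := by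
  have hp := M.isProbabilityMeasure_predictor hb χ hg
  rw [asympVar, Finset.sum_range_succ, M.asympVar_top_term χ (n + 1) hh]
  congr 1
  rw [asympVar]
  refine Finset.sum_congr rfl fun k hk => ?_
  have hkn : k + (n - k) = n := by have := Finset.mem_range.1 hk; omega
  have hkn' : n + 1 - k = n - k + 1 := by have := Finset.mem_range.1 hk; omega
  have hgb := M.bddMeas_g (hb n)
  have hG := M.integral_g_predictor_pos hb χ hg n
  have hD := M.integral_predictor_mul hb χ hg k (n - k) hgb
  rw [hkn] at hD
  rw [M.integral_pullback hb χ hg n hh, hkn']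
  simp_rw [M.integral_L_succ hb k (n - k) _ hh, M.integral_L_succ hb k (n - k) _ (BddMeas.const 1),
    hkn]
  simp only [zero_mul, sub_zero]
  have h1 : (fun x => ∫ z, M.g z (y n) * ∫ _w, (1 : ℝ) ∂(M.Q z) ∂(M.L y k (n - k) x))
      = fun x => ∫ z, M.g z (y n) ∂(M.L y k (n - k) x) := by
    simp
  -- The denominator at horizon `n + 1` is the one at horizon `n` times the predictor mean of `g(·,
  -- y_n)`; this extra factor is the one divided out in `pullback`.
  rw [h1, ← hD]
  refine integral_congr_ae (ae_of_all _ fun x => ?_)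
  have := M.isFiniteKernel_L hb k (n - k)
  have h2 : ∫ z, M.pullback χ y n h z ∂(M.L y k (n - k) x)
      = ((∫ z, M.g z (y n) * ∫ w, h w ∂(M.Q z) ∂(M.L y k (n - k) x))
          - (∫ z, h z ∂(M.predictor χ y (n + 1))) * ∫ z, M.g z (y n) ∂(M.L y k (n - k) x))
        / ∫ z, M.g z (y n) ∂(M.predictor χ y n) := by
    simp only [pullback, integral_div, mul_sub]
    rw [integral_sub ((hgb.mul (hh.kernel_integral M.Q)).integrable _)
      ((hgb.mul (BddMeas.const _)).integrable _), integral_mul_const, mul_comm (∫ z, h z ∂_)]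
  have h3 : ∫ z, M.g z (y n) * ∫ _w, (1 : ℝ) ∂(M.Q z) ∂(M.L y k (n - k) x)
      = ∫ z, M.g z (y n) ∂(M.L y k (n - k) x) := congrFun h1 x
  simp only [h2, h3]
  rw [div_div]

end Predictor

end HMM

/-! ### Central limit theorem and Hoeffding bounds for i.i.d. samples. -/

lemma norm_pow_sub_pow_le_mul {a b : ℂ} (ha : ‖a‖ ≤ 1) (hb : ‖b‖ ≤ 1) (N : ℕ) :
    ‖a ^ N - b ^ N‖ ≤ N * ‖a - b‖ := by
  induction N with
  | zero => simp
  | succ N ih =>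
    have h1 : a ^ (N + 1) - b ^ (N + 1) = a ^ N * (a - b) + (a ^ N - b ^ N) * b := by ring
    calc ‖a ^ (N + 1) - b ^ (N + 1)‖ ≤ ‖a ^ N * (a - b)‖ + ‖(a ^ N - b ^ N) * b‖ := by
          rw [h1]; exact norm_add_le _ _
      _ ≤ 1 * ‖a - b‖ + (N * ‖a - b‖) * 1 := by
          rw [norm_mul, norm_mul, norm_pow]
          gcongr
          exact pow_le_one₀ (norm_nonneg _) ha
      _ = (N + 1 : ℕ) * ‖a - b‖ := by push_cast; ring

/-- The error of the empirical mean as an estimate of `c`, scaled by the square root of the sample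
size. -/
def scaledError {X : Type*} (h : X → ℝ) (c : ℝ) {N : ℕ} (x : Fin N → X) : ℝ :=
  √(N : ℝ) * (empMean h x - c)

section IID

variable {X : Type*} [MeasurableSpace X]

omit [MeasurableSpace X] in
lemma scaledError_eq_sum (h : X → ℝ) (c : ℝ) {N : ℕ} [NeZero N] (x : Fin N → X) :
    scaledError h c x = ∑ i, (√(N : ℝ))⁻¹ * (h (x i) - c) := by
  have hN : (0 : ℝ) < N := by exact_mod_cast NeZero.pos N
  have hs : √(N : ℝ) * √(N : ℝ) = N := Real.mul_self_sqrt hN.le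
  have hs0 : √(N : ℝ) ≠ 0 := (Real.sqrt_pos.2 hN).ne'
  rw [← Finset.mul_sum, Finset.sum_sub_distrib, scaledError, empMean]
  simp only [Finset.sum_const, Finset.card_univ, Fintype.card_fin, nsmul_eq_mul]
  rw [← mul_right_inj' hs0, ← mul_assoc, ← mul_assoc, hs, mul_inv_cancel₀ hs0]
  field_simp

lemma measurable_scaledError {h : X → ℝ} (hh : Measurable h) (c : ℝ) (N : ℕ) :
    Measurable fun x : Fin N → X => scaledError h c x := by
  unfold scaledError empMean
  fun_prop

omit [MeasurableSpace X] in
lemma abs_empMean_le {h : X → ℝ} {C : ℝ} (hC : ∀ x, |h x| ≤ C) {N : ℕ} [NeZero N] (x : Fin N → X) :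
    |empMean h x| ≤ C := by
  have hN : (0 : ℝ) < N := by exact_mod_cast NeZero.pos N
  rw [empMean, abs_div, abs_of_pos hN, div_le_iff₀ hN]
  refine (Finset.abs_sum_le_sum_abs _ _).trans ?_
  refine (Finset.sum_le_sum fun i _ => hC (x i)).trans ?_
  simp [mul_comm]

lemma bddMeas_scaledError {h : X → ℝ} (hh : BddMeas h) (c : ℝ) (N : ℕ) [NeZero N] :
    BddMeas fun x : Fin N → X => scaledError h c x := by
  obtain ⟨C, hC⟩ := hh.bdd
  refine ⟨measurable_scaledError hh.measurable c N, √(N : ℝ) * (C + |c|), fun x => ?_⟩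
  rw [scaledError, abs_mul, abs_of_nonneg (Real.sqrt_nonneg _)]
  gcongr
  exact (abs_sub _ _).trans (add_le_add (abs_empMean_le hC x) le_rfl)

variable (ρ : Measure X) [IsProbabilityMeasure ρ] {h : X → ℝ}

lemma abs_integral_le_of_bound {C : ℝ} (hC : ∀ x, |h x| ≤ C) : |∫ x, h x ∂ρ| ≤ C := by
  simpa using norm_integral_le_of_norm_le_const (μ := ρ) (f := h) (ae_of_all _ hC)

/-- Taylor expansion of order two: the linear term vanishes by centring. The cubic remainder carries
an exponential factor, which `s ≤ 1` bounds by `exp (2C)`. -/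
lemma norm_integral_cexp_sub_le (hh : BddMeas h) {C s : ℝ} (hC0 : 0 ≤ C) (hC : ∀ x, |h x| ≤ C)
    (hs0 : 0 ≤ s) (hs1 : s ≤ 1) :
    ‖∫ x, Complex.exp (Complex.I * ((s * (h x - ∫ z, h z ∂ρ) : ℝ) : ℂ)) ∂ρ
        - ((1 - s ^ 2 * (∫ x, (h x - ∫ z, h z ∂ρ) ^ 2 ∂ρ) / 2 : ℝ) : ℂ)‖
      ≤ s ^ 3 * ((2 * C) ^ 3 * Real.exp (2 * C)) := by
  set m := ∫ z, h z ∂ρ with hm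
  have hmC : |m| ≤ C := abs_integral_le_of_bound ρ hC
  have hb0 : BddMeas fun x => h x - m := hh.sub (BddMeas.const m)
  have hd (x : X) : |h x - m| ≤ 2 * C := by
    refine (abs_sub _ _).trans ?_
    have := hC x
    linarith
  have i1 : Integrable (fun x => s * (h x - m)) ρ := (hb0.integrable ρ).const_mul s
  have i2 : Integrable (fun x => s ^ 2 * (h x - m) ^ 2 / 2) ρ := by
    simp only [pow_two (h _ - m)]
    exact ((hb0.mul hb0).integrable ρ |>.const_mul (s ^ 2)).div_const 2
  have i3 : Integrable (fun x => Complex.I * ((s * (h x - m) : ℝ) : ℂ)) ρ :=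
    i1.ofReal.const_mul Complex.I
  have i2' : Integrable (fun x => ((s ^ 2 * (h x - m) ^ 2 / 2 : ℝ) : ℂ)) ρ := i2.ofReal
  have i4 : Integrable (fun x => (1 : ℂ) + Complex.I * ((s * (h x - m) : ℝ) : ℂ)) ρ :=
    (integrable_const _).add i3
  have hT : ∫ x, ((1 : ℂ) + Complex.I * ((s * (h x - m) : ℝ) : ℂ)
        - ((s ^ 2 * (h x - m) ^ 2 / 2 : ℝ) : ℂ)) ∂ρ
      = ((1 - s ^ 2 * (∫ x, (h x - m) ^ 2 ∂ρ) / 2 : ℝ) : ℂ) := by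
    rw [integral_sub i4 i2',
      integral_add (integrable_const _) i3, integral_const_mul, integral_complex_ofReal,
      integral_complex_ofReal, integral_const_mul, integral_sub (hh.integrable ρ) (integrable_const _), integral_div,
      integral_const_mul]
    simp [← hm]
  rw [← hT, ← integral_sub]
  · have hbd := norm_integral_le_of_norm_le_const (μ := ρ)
      (f := fun x => Complex.exp (Complex.I * ((s * (h x - m) : ℝ) : ℂ))
        - ((1 : ℂ) + Complex.I * ((s * (h x - m) : ℝ) : ℂ)
        - ((s ^ 2 * (h x - m) ^ 2 / 2 : ℝ) : ℂ)))
      (C := s ^ 3 * ((2 * C) ^ 3 * Real.exp (2 * C))) (ae_of_all _ fun x => ?_)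
    · simpa using hbd
    · have h1 := Complex.norm_exp_sub_sum_le_norm_mul_exp
        (Complex.I * ((s * (h x - m) : ℝ) : ℂ)) 3
      have h2 : ∑ j ∈ Finset.range 3, (Complex.I * ((s * (h x - m) : ℝ) : ℂ)) ^ j / (j.factorial : ℂ)
          = (1 : ℂ) + Complex.I * ((s * (h x - m) : ℝ) : ℂ)
            - ((s ^ 2 * (h x - m) ^ 2 / 2 : ℝ) : ℂ) := by
        simp only [Finset.sum_range_succ, Finset.sum_range_zero]
        simp only [Nat.factorial, mul_pow, Complex.I_sq]
        push_cast
        ring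
      rw [h2] at h1
      refine h1.trans ?_
      have h3 : ‖Complex.I * ((s * (h x - m) : ℝ) : ℂ)‖ = s * |h x - m| := by
        rw [norm_mul, Complex.norm_I, one_mul, Complex.norm_real, Real.norm_eq_abs, abs_mul,
          abs_of_nonneg hs0]
      rw [h3, mul_pow, mul_assoc]
      have h4 : s * |h x - m| ≤ 2 * C :=
        (mul_le_mul hs1 (hd x) (abs_nonneg _) zero_le_one).trans_eq (one_mul _)
      have := hd x
      gcongr
  · refine Integrable.of_bound (C := 1) ?_ (ae_of_all _ fun x => ?_)
    · have := hb0.measurable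
      exact Measurable.aestronglyMeasurable (by fun_prop)
    · rw [mul_comm, Complex.norm_exp_ofReal_mul_I]
  · exact i4.sub i2'

/-- A quantitative central limit theorem for the characteristic function of a normalized sum of
bounded i.i.d. variables, uniform over the law. -/
lemma norm_integral_cexp_scaledError_sub_le (hh : BddMeas h) {C : ℝ} (hC0 : 0 ≤ C)
    (hC : ∀ x, |h x| ≤ C) (N : ℕ) [NeZero N] :
    ‖∫ x, Complex.exp (Complex.I * (scaledError h (∫ z, h z ∂ρ) x : ℂ))
          ∂(Measure.pi fun _ : Fin N => ρ)
        - Complex.exp ((-(∫ x, (h x - ∫ z, h z ∂ρ) ^ 2 ∂ρ) / 2 : ℝ) : ℂ)‖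
      ≤ ((2 * C) ^ 3 * Real.exp (2 * C) + 4 * C ^ 4 * Real.exp (2 * C ^ 2)) / √(N : ℝ) := by
  set m := ∫ z, h z ∂ρ with hm
  set v := ∫ x, (h x - m) ^ 2 ∂ρ with hv
  set s := (√(N : ℝ))⁻¹ with hs
  have hN : (1 : ℝ) ≤ N := by exact_mod_cast NeZero.one_le (n := N)
  have hsq : 1 ≤ √(N : ℝ) := Real.one_le_sqrt.2 hN
  have hs0 : 0 ≤ s := inv_nonneg.2 (Real.sqrt_nonneg _)
  have hs1 : s ≤ 1 := inv_le_one_of_one_le₀ hsq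
  have hNs : N * s ^ 2 = 1 := by
    rw [hs, inv_pow, Real.sq_sqrt (by linarith), mul_inv_cancel₀ (by linarith)]
  have hmC : |m| ≤ C := abs_integral_le_of_bound ρ hC
  have hd (x : X) : |h x - m| ≤ 2 * C := by
    refine (abs_sub _ _).trans ?_
    have := hC x
    linarith
  have hv0 : 0 ≤ v := integral_nonneg fun x => sq_nonneg _
  have hv1 : v ≤ (2 * C) ^ 2 := by
    refine (le_abs_self _).trans (abs_integral_le_of_bound ρ fun x => ?_)
    rw [abs_pow]
    exact pow_le_pow_left₀ (abs_nonneg _) (hd x) 2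
  have hprod (x : Fin N → X) : Complex.exp (Complex.I * (scaledError h m x : ℂ))
      = ∏ i, Complex.exp (Complex.I * ((s * (h (x i) - m) : ℝ) : ℂ)) := by
    rw [scaledError_eq_sum, Complex.ofReal_sum, Finset.mul_sum, Complex.exp_sum]
  simp_rw [hprod]
  rw [integral_fintype_prod_eq_pow (ι := Fin N)
    (fun z => Complex.exp (Complex.I * ((s * (h z - m) : ℝ) : ℂ))), Fintype.card_fin]
  have hb : Complex.exp ((-v / 2 : ℝ) : ℂ) = Complex.exp ((-(s ^ 2 * v / 2) : ℝ) : ℂ) ^ N := by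
    rw [← Complex.exp_nat_mul]
    congr 1
    rw [← Complex.ofReal_natCast, ← Complex.ofReal_mul]
    congr 1
    linear_combination (-v / 2) * (-hNs)
  rw [hb]
  have hw0 : 0 ≤ s ^ 2 * v / 2 := by positivity
  have hw1 : s ^ 2 * v / 2 ≤ 2 * C ^ 2 := by
    have : s ^ 2 ≤ 1 := pow_le_one₀ hs0 hs1
    nlinarith
  have hna : ‖∫ x, Complex.exp (Complex.I * ((s * (h x - m) : ℝ) : ℂ)) ∂ρ‖ ≤ 1 := by
    have := norm_integral_le_of_norm_le_const (μ := ρ)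
      (f := fun x => Complex.exp (Complex.I * ((s * (h x - m) : ℝ) : ℂ))) (C := 1)
      (ae_of_all _ fun x => by rw [mul_comm, Complex.norm_exp_ofReal_mul_I])
    simpa using this
  have hnb : ‖Complex.exp ((-(s ^ 2 * v / 2) : ℝ) : ℂ)‖ ≤ 1 := by
    rw [Complex.norm_exp_ofReal]
    exact Real.exp_le_one_iff.2 (by linarith)
  -- Both characteristic functions are `N`-th powers of numbers in the unit disc, so it suffices
  -- that the bases differ by `O(s³)`, as `N s³ = N^{-1/2}`. Both bases are compared with `1 - s² v
  -- / 2`.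
  refine (norm_pow_sub_pow_le_mul hna hnb N).trans ?_
  have hA := norm_integral_cexp_sub_le ρ hh hC0 hC hs0 hs1
  rw [← hm, ← hv] at hA
  have hB : ‖Complex.exp ((-(s ^ 2 * v / 2) : ℝ) : ℂ) - ((1 - s ^ 2 * v / 2 : ℝ) : ℂ)‖
      ≤ s ^ 3 * (4 * C ^ 4 * Real.exp (2 * C ^ 2)) := by
    have h1 := Complex.norm_exp_sub_sum_le_norm_mul_exp ((-(s ^ 2 * v / 2) : ℝ) : ℂ) 2
    have h2 : ∑ j ∈ Finset.range 2, ((-(s ^ 2 * v / 2) : ℝ) : ℂ) ^ j / (j.factorial : ℂ)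
        = ((1 - s ^ 2 * v / 2 : ℝ) : ℂ) := by
      simp only [Finset.sum_range_succ, Finset.sum_range_zero]
      simp [sub_eq_add_neg]
    rw [h2, Complex.norm_real, Real.norm_eq_abs, abs_neg, abs_of_nonneg hw0] at h1
    refine h1.trans ?_
    -- One factor `s ≤ 1` is given up, to match the order `s³` of the other error.
    have h5 : (s ^ 2 * v / 2) ^ 2 ≤ s ^ 3 * (4 * C ^ 4) := by
      calc (s ^ 2 * v / 2) ^ 2 = s ^ 3 * (s * (v ^ 2 / 4)) := by ring
        _ ≤ s ^ 3 * (1 * (((2 * C) ^ 2) ^ 2 / 4)) := by gcongr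
        _ = s ^ 3 * (4 * C ^ 4) := by ring
    rw [← mul_assoc]
    gcongr
  have hAB := norm_sub_le_norm_sub_add_norm_sub
    (∫ x, Complex.exp (Complex.I * ((s * (h x - m) : ℝ) : ℂ)) ∂ρ)
    ((1 - s ^ 2 * v / 2 : ℝ) : ℂ) (Complex.exp ((-(s ^ 2 * v / 2) : ℝ) : ℂ))
  rw [norm_sub_rev ((1 - s ^ 2 * v / 2 : ℝ) : ℂ)] at hAB
  calc _ ≤ N * (s ^ 3 * ((2 * C) ^ 3 * Real.exp (2 * C))
        + s ^ 3 * (4 * C ^ 4 * Real.exp (2 * C ^ 2))) := by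
        gcongr
        linarith
    _ = (N * s ^ 2) * (((2 * C) ^ 3 * Real.exp (2 * C) + 4 * C ^ 4 * Real.exp (2 * C ^ 2)) * s) := by
        ring
    _ = _ := by rw [hNs, one_mul, hs, div_eq_mul_inv]

/-- Hoeffding's lemma on `[-C, C]` gives each factor the variance proxy `C²`; the `N` factors and
the scaling `s² = 1/N` cancel. -/
lemma integral_exp_scaledError_le (hh : BddMeas h) {C : ℝ} (hC0 : 0 ≤ C)
    (hC : ∀ x, |h x| ≤ C) (N : ℕ) [NeZero N] (t : ℝ) :
    ∫ x, Real.exp (t * scaledError h (∫ z, h z ∂ρ) x) ∂(Measure.pi fun _ : Fin N => ρ)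
      ≤ Real.exp (C ^ 2 * t ^ 2 / 2) := by
  set m := ∫ z, h z ∂ρ with hm
  set s := (√(N : ℝ))⁻¹ with hs
  have hN : (0 : ℝ) < N := by exact_mod_cast NeZero.pos N
  have hNs : N * s ^ 2 = 1 := by
    rw [hs, inv_pow, Real.sq_sqrt hN.le, mul_inv_cancel₀ hN.ne']
  have hprod (x : Fin N → X) : Real.exp (t * scaledError h m x)
      = ∏ i, Real.exp (t * s * (h (x i) - m)) := by
    rw [scaledError_eq_sum, ← Real.exp_sum, Finset.mul_sum]
    simp_rw [mul_assoc]
    rfl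
  simp_rw [hprod]
  rw [integral_fintype_prod_eq_pow (ι := Fin N) (fun z => Real.exp (t * s * (h z - m))),
    Fintype.card_fin]
  have h1 := (hasSubgaussianMGF_of_mem_Icc (μ := ρ) (a := -C) (b := C) hh.measurable.aemeasurable
    (ae_of_all _ fun x => abs_le.1 (hC x))).mgf_le (t * s)
  rw [mgf, ← hm] at h1
  have h2 : ((((‖C - -C‖₊ / 2) ^ 2 : NNReal)) : ℝ) = C ^ 2 := by
    rw [sub_neg_eq_add, ← two_mul]
    simp [abs_of_nonneg hC0]
  rw [h2] at h1
  calc _ ≤ (Real.exp (C ^ 2 * (t * s) ^ 2 / 2)) ^ N :=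
        pow_le_pow_left₀ (integral_nonneg fun x => (Real.exp_pos _).le) h1 N
    _ = Real.exp (C ^ 2 * t ^ 2 / 2) := by
        rw [← Real.exp_nat_mul]
        congr 1
        linear_combination (C ^ 2 * t ^ 2 / 2) * hNs

lemma exp_mul_abs_le (t s : ℝ) : Real.exp (t * |s|) ≤ Real.exp (t * s) + Real.exp (-t * s) := by
  rcases abs_cases s with ⟨h, -⟩ | ⟨h, -⟩ <;> rw [h]
  · linarith [Real.exp_pos (-t * s)]
  · rw [mul_neg, ← neg_mul]
    linarith [Real.exp_pos (t * s)]

/-- Exponentials of bounded measurable functions are bounded measurable. -/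
lemma BddMeas.exp (hh : BddMeas h) : BddMeas fun x => Real.exp (h x) := by
  obtain ⟨C, hC⟩ := hh.bdd
  refine ⟨hh.measurable.exp, Real.exp C, fun x => ?_⟩
  rw [abs_of_pos (Real.exp_pos _)]
  exact Real.exp_le_exp.2 ((le_abs_self _).trans (hC x))

lemma BddMeas.abs (hh : BddMeas h) : BddMeas fun x => |h x| := by
  obtain ⟨C, hC⟩ := hh.bdd
  exact ⟨hh.measurable.abs, C, fun x => by rw [abs_abs]; exact hC x⟩

lemma integral_exp_mul_abs_scaledError_le (hh : BddMeas h) {C : ℝ} (hC0 : 0 ≤ C)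
    (hC : ∀ x, |h x| ≤ C) (N : ℕ) [NeZero N] (t : ℝ) :
    ∫ x, Real.exp (t * |scaledError h (∫ z, h z ∂ρ) x|) ∂(Measure.pi fun _ : Fin N => ρ)
      ≤ 2 * Real.exp (C ^ 2 * t ^ 2 / 2) := by
  set m := ∫ z, h z ∂ρ with hm
  have hS := bddMeas_scaledError hh m N
  have hi (t : ℝ) : Integrable (fun x => Real.exp (t * scaledError h m x))
      (Measure.pi fun _ : Fin N => ρ) := ((BddMeas.const t).mul hS).exp.integrable _
  calc _ ≤ ∫ x, (Real.exp (t * scaledError h m x) + Real.exp (-t * scaledError h m x))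
          ∂(Measure.pi fun _ : Fin N => ρ) :=
        integral_mono (((BddMeas.const t).mul hS.abs).exp.integrable _) ((hi t).add (hi (-t)))
          fun x => exp_mul_abs_le _ _
    _ ≤ 2 * Real.exp (C ^ 2 * t ^ 2 / 2) := by
        rw [integral_add (hi t) (hi (-t)), two_mul]
        have h1 := integral_exp_scaledError_le ρ hh hC0 hC N t
        have h2 := integral_exp_scaledError_le ρ hh hC0 hC N (-t)
        rw [neg_sq] at h2
        exact add_le_add h1 h2

end IID

/-! ### Elementary inequalities for the one-step error. -/

lemma exp_add_add_le (a b c : ℝ) :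
    Real.exp (a + b + c) ≤ Real.exp (3 * a) + Real.exp (3 * b) + Real.exp (3 * c) := by
  have ha := Real.exp_pos (3 * a)
  have hb := Real.exp_pos (3 * b)
  have hc := Real.exp_pos (3 * c)
  by_cases h1 : a + b + c ≤ 3 * a
  · linarith [Real.exp_le_exp.2 h1]
  by_cases h2 : a + b + c ≤ 3 * b
  · linarith [Real.exp_le_exp.2 h2]
  have h3 : a + b + c ≤ 3 * c := by linarith
  linarith [Real.exp_le_exp.2 h3]

lemma norm_cexp_I_mul_sub_le (a b : ℝ) :
    ‖Complex.exp (Complex.I * (a : ℂ)) - Complex.exp (Complex.I * (b : ℂ))‖ ≤ |a - b| := by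
  have h1 : Complex.exp (Complex.I * (a : ℂ)) - Complex.exp (Complex.I * (b : ℂ))
      = Complex.exp (Complex.I * (b : ℂ)) * (Complex.exp (Complex.I * ((a - b : ℝ) : ℂ)) - 1) := by
    rw [mul_sub, ← Complex.exp_add, mul_one]
    congr 2
    push_cast
    ring
  rw [h1, norm_mul, mul_comm Complex.I (b : ℂ), Complex.norm_exp_ofReal_mul_I, one_mul]
  exact Real.norm_exp_I_mul_ofReal_sub_one_le

lemma abs_exp_neg_half_sub_le {a b : ℝ} (ha : 0 ≤ a) (hb : 0 ≤ b) :
    |Real.exp (-a / 2) - Real.exp (-b / 2)| ≤ |a - b| / 2 := by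
  wlog hab : a ≤ b generalizing a b
  · rw [abs_sub_comm, abs_sub_comm a]
    exact this hb ha (le_of_not_ge hab)
  have h1 : Real.exp (-b / 2) ≤ Real.exp (-a / 2) := Real.exp_le_exp.2 (by linarith)
  rw [abs_of_nonneg (by linarith), abs_of_nonpos (by linarith)]
  have h2 : Real.exp (-b / 2) = Real.exp (-a / 2) * Real.exp (-(b - a) / 2) := by
    rw [← Real.exp_add]; congr 1; ring
  have h3 : 1 - (b - a) / 2 ≤ Real.exp (-(b - a) / 2) := by
    have := Real.add_one_le_exp (-(b - a) / 2)
    linarith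
  have h4 : Real.exp (-a / 2) ≤ 1 := Real.exp_le_one_iff.2 (by linarith)
  have h5 := Real.exp_pos (-a / 2)
  rw [h2]
  nlinarith

/-- With variances written through raw moments, the difference of two of them is controlled by the
biases for `h` and for `h²`. -/
lemma integral_sub_sq_eq {X : Type*} [MeasurableSpace X] (ρ : Measure X) [IsProbabilityMeasure ρ]
    {h : X → ℝ} (hh : BddMeas h) :
    ∫ x, (h x - ∫ z, h z ∂ρ) ^ 2 ∂ρ = (∫ x, h x * h x ∂ρ) - (∫ z, h z ∂ρ) ^ 2 := by
  set m := ∫ z, h z ∂ρ with hm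
  have h1 : (fun x => (h x - m) ^ 2) = fun x => h x * h x - (2 * m * h x - m ^ 2) := by
    ext x; ring
  have h2 : Integrable (fun x => 2 * m * h x - m ^ 2) ρ :=
    ((hh.integrable ρ).const_mul _).sub (integrable_const _)
  rw [h1, integral_sub ((hh.mul hh).integrable ρ) h2,
    integral_sub ((hh.integrable ρ).const_mul _) (integrable_const _), integral_const_mul, ← hm]
  simp
  ring

/-- Here `s = √N`, `r` and `r₂` are the mixture biases for `h` and `h²`, `a`, `a₂`, `b` are the
scaled errors of the two pullbacks and of the normalized likelihood, `d` is the variance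
discrepancy, and `D` is the constant of the i.i.d. estimate. Every term is reduced to a constant
plus squares, so second moments suffice afterwards. -/
lemma remainder_le {C D s r r₂ a a₂ b d : ℝ} (hC0 : 0 ≤ C) (hs : 0 < s)
    (h₁ : s * |r| ≤ |a| + 2 * C * |b|) (h₂ : s * |r₂| ≤ |a₂| + 2 * (C * C) * |b|)
    (hd : d ≤ |r₂| + |r| * (2 * C)) :
    D + d / 2 * s + s * |r| * |b|
      ≤ (D + 1 / 2 + 3 * (C * C) + C) + (C + 1) * (a * a) + (1 / 2) * (a₂ * a₂)
        + (C * C + 2 * C * C + 1 + 2 * C) * (b * b) := by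
  have q (s : ℝ) : |s| ≤ 1 + s * s := by
    rw [← abs_mul_abs_self s]; nlinarith [sq_nonneg (|s| - 1), abs_nonneg s]
  have q2 : |a| * |b| ≤ a * a + b * b := by
    rw [← abs_mul_abs_self a, ← abs_mul_abs_self b]
    nlinarith [sq_nonneg (|a| - |b|), mul_nonneg (abs_nonneg a) (abs_nonneg b)]
  have t0 : d / 2 * s ≤ (|r₂| + |r| * (2 * C)) / 2 * s := by gcongr
  have t0' : (|r₂| + |r| * (2 * C)) / 2 * s = s * |r₂| / 2 + s * |r| * C := by ring
  have t1 : s * |r| * C ≤ (|a| + 2 * C * |b|) * C := by gcongr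
  have t1' : (|a| + 2 * C * |b|) * C = |a| * C + 2 * (C * C * |b|) := by ring
  have t2 : s * |r| * |b| ≤ (|a| + 2 * C * |b|) * |b| := by gcongr
  have t3 : |a| * C ≤ (1 + a * a) * C := by gcongr; exact q a
  have t4 : C * C * |b| ≤ C * C * (1 + b * b) := by gcongr; exact q b
  have t5 : (|a| + 2 * C * |b|) * |b| = |a| * |b| + 2 * C * (b * b) := by
    rw [← abs_mul_abs_self b]; ring
  have t6 := q a₂
  have goal_eq : (D + 1 / 2 + 3 * (C * C) + C) + (C + 1) * (a * a) + (1 / 2) * (a₂ * a₂)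
        + (C * C + 2 * C * C + 1 + 2 * C) * (b * b)
      = D + (1 + a₂ * a₂) / 2 + 3 * (C * C * (1 + b * b)) + (1 + a * a) * C + (a * a + b * b)
        + 2 * C * (b * b) := by ring
  rw [goal_eq]
  linarith

/-! ### Propagation of the scaled error through one step, and induction on time. -/

namespace HMM

variable {X Y : Type*} [MeasurableSpace X] [MeasurableSpace Y] (M : HMM X Y)

lemma integral_mixture (y : Y) {N : ℕ} [NeZero N] (x : Fin N → X) {h : X → ℝ}
    (hh : BddMeas h) :
    ∫ z, h z ∂(M.mixture y x)
      = (∑ j, M.g (x j) y * ∫ z, h z ∂(M.Q (x j))) / ∑ l, M.g (x l) y := by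
  rw [mixture, integral_finsetSum_measure
    fun j _ => (hh.integrable _).smul_measure ENNReal.ofReal_ne_top, Finset.sum_div]
  refine Finset.sum_congr rfl fun j _ => ?_
  rw [integral_smul_measure, ENNReal.toReal_ofReal (div_nonneg (M.g_nonneg _ _)
    (Finset.sum_nonneg fun l _ => M.g_nonneg _ _)), smul_eq_mul]
  ring

variable {y : ℕ → Y} (hb : ∀ k, ∃ B, ∀ x, M.g x (y k) ≤ B) (hg : ∀ x y, 0 < M.g x y)
  (χ : Measure X) [IsProbabilityMeasure χ]

/-- The scaled error of the particle approximation of `predictor χ y n`. -/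
def predError (y : ℕ → Y) (n : ℕ) (h : X → ℝ) {N : ℕ} (x : Fin N → X) : ℝ :=
  scaledError h (∫ z, h z ∂(M.predictor χ y n)) x

omit [IsProbabilityMeasure χ] in
lemma bddMeas_predError (n : ℕ) {h : X → ℝ} (hh : BddMeas h) (N : ℕ) [NeZero N] :
    BddMeas fun x : Fin N → X => M.predError χ y n h x :=
  bddMeas_scaledError hh _ N

/-- The likelihood normalized by its mean under the predictor. -/
def normLik (y : ℕ → Y) (n : ℕ) (x : X) : ℝ :=
  M.g x (y n) / ∫ z, M.g z (y n) ∂(M.predictor χ y n)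

omit [IsProbabilityMeasure χ] in
include hb in
lemma bddMeas_normLik (n : ℕ) : BddMeas (M.normLik χ y n) :=
  (M.bddMeas_g (hb n)).div_const _

/-- The bias of the mixture proposal with respect to the next predictor. -/
def mixBias (y : ℕ → Y) (n : ℕ) (h : X → ℝ) {N : ℕ} (x : Fin N → X) : ℝ :=
  ∫ z, h z ∂(M.mixture (y n) x) - ∫ z, h z ∂(M.predictor χ y (n + 1))

-- The mixture mean is a ratio of empirical means, so the empirical mean of `pullback` equals the
-- bias times that of `normLik`. The latter is `1` plus its scaled error over `√N`, which gives the
-- second-order term.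
include hb hg in
lemma sqrt_mul_mixBias (n : ℕ) {h : X → ℝ} (hh : BddMeas h) {N : ℕ} [NeZero N]
    (x : Fin N → X) :
    √(N : ℝ) * M.mixBias χ y n h x
      = M.predError χ y n (M.pullback χ y n h) x
        - M.mixBias χ y n h x * M.predError χ y n (M.normLik χ y n) x := by
  have hG := M.integral_g_predictor_pos hb χ hg n
  have hs := M.sum_g_pos hg (y n) x
  have hN : (0 : ℝ) < N := by exact_mod_cast NeZero.pos N
  have h1 : ∫ z, M.normLik χ y n z ∂(M.predictor χ y n) = 1 := by
    simp only [normLik, integral_div]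
    exact div_self hG.ne'
  have h2 : empMean (M.pullback χ y n h) x
      = M.mixBias χ y n h x * empMean (M.normLik χ y n) x := by
    have h3 : ∑ i, M.g (x i) (y n) *
        (∫ z, h z ∂(M.Q (x i)) - ∫ z, h z ∂(M.predictor χ y (n + 1)))
        = M.mixBias χ y n h x * ∑ i, M.g (x i) (y n) := by
      rw [mixBias, M.integral_mixture _ _ hh]
      simp only [mul_sub, Finset.sum_sub_distrib, ← Finset.sum_mul]
      field_simp
    simp only [empMean, pullback, normLik, ← Finset.sum_div]
    rw [h3]
    ring
  rw [predError, predError, M.integral_pullback hb χ hg n hh, h1, scaledError, scaledError, h2]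
  ring

include hb hg in
lemma abs_mixBias_le (n : ℕ) {h : X → ℝ} {C : ℝ} (hC : ∀ x, |h x| ≤ C)
    {N : ℕ} [NeZero N] (x : Fin N → X) : |M.mixBias χ y n h x| ≤ 2 * C := by
  have := M.isProbabilityMeasure_predictor hb χ hg (n + 1)
  have := M.isProbabilityMeasure_mixture hg (y n) x
  refine (abs_sub _ _).trans ?_
  linarith [abs_integral_le_of_bound (M.mixture (y n) x) hC,
    abs_integral_le_of_bound (M.predictor χ y (n + 1)) hC]

include hb hg in
lemma abs_sqrt_mul_mixBias_le (n : ℕ) {h : X → ℝ} (hh : BddMeas h) {C : ℝ}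
    (hC : ∀ x, |h x| ≤ C) {N : ℕ} [NeZero N] (x : Fin N → X) :
    |√(N : ℝ) * M.mixBias χ y n h x|
      ≤ |M.predError χ y n (M.pullback χ y n h) x|
        + 2 * C * |M.predError χ y n (M.normLik χ y n) x| := by
  rw [M.sqrt_mul_mixBias hb hg χ n hh x]
  refine (abs_sub _ _).trans ?_
  rw [abs_mul]
  gcongr
  exact M.abs_mixBias_le hb hg χ n hC x

-- Splits the error into a part that is i.i.d. and centred given `x`, and a part that is a function
-- of `x` alone.
omit [IsProbabilityMeasure χ] in
lemma predError_succ (n : ℕ) (h : X → ℝ) {N : ℕ} (x x' : Fin N → X) :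
    M.predError χ y (n + 1) h x'
      = scaledError h (∫ z, h z ∂(M.mixture (y n) x)) x' + √(N : ℝ) * M.mixBias χ y n h x := by
  rw [predError, scaledError, scaledError, mixBias]
  ring

include hb in
/-- The scaled errors have exponential moments, uniformly in the number of particles. -/
theorem exists_integral_exp_predError_le (n : ℕ) {h : X → ℝ} (hh : BddMeas h) {t : ℝ}
    (ht : 0 ≤ t) :
    ∃ K, ∀ (N : ℕ) [NeZero N],
      ∫ x, Real.exp (t * |M.predError χ y n h x|) ∂(M.particleKernel hg χ N n y) ≤ K := by
  induction n generalizing h t with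
  | zero =>
    obtain ⟨C, hC0, hC⟩ := hh.exists_bound
    refine ⟨2 * Real.exp (C ^ 2 * t ^ 2 / 2), fun N _ => ?_⟩
    simp only [predError, predictor_zero, particleKernel_zero_apply]
    exact integral_exp_mul_abs_scaledError_le χ hh hC0 hC N t
  | succ n ih =>
    obtain ⟨C, hC0, hC⟩ := hh.exists_bound
    -- The factor `3` comes from `exp_add_add_le`, which separates the three dependent terms; `2 *
    -- C` bounds the bias multiplying the error of `normLik`.
    obtain ⟨K₁, hK₁⟩ := ih (M.bddMeas_pullback hb χ n hh) (t := 3 * t) (by positivity)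
    obtain ⟨K₂, hK₂⟩ := ih (M.bddMeas_normLik hb χ n) (t := 3 * t * (2 * C)) (by positivity)
    refine ⟨2 * Real.exp (C ^ 2 * (3 * t) ^ 2 / 2) + K₁ + K₂, fun N _ => ?_⟩
    have hS := M.bddMeas_predError (y := y) χ (n + 1) hh N
    rw [M.integral_particleKernel_succ hg χ N n y
      (((BddMeas.const t).mul hS.abs).exp.integrable _)]
    set f := M.pullback χ y n h
    set w := M.normLik χ y n
    have i1 : Integrable (fun x => Real.exp (3 * t * |M.predError χ y n f x|))
        (M.particleKernel hg χ N n y) :=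
      ((BddMeas.const (3 * t)).mul
        (M.bddMeas_predError χ n (M.bddMeas_pullback hb χ n hh) N).abs).exp.integrable _
    have i2 : Integrable (fun x => Real.exp (3 * t * (2 * C) * |M.predError χ y n w x|))
        (M.particleKernel hg χ N n y) :=
      ((BddMeas.const (3 * t * (2 * C))).mul
        (M.bddMeas_predError χ n (M.bddMeas_normLik hb χ n) N).abs).exp.integrable _
    have i0 : Integrable (fun x => 2 * Real.exp (C ^ 2 * (3 * t) ^ 2 / 2)
        + Real.exp (3 * t * |M.predError χ y n f x|)) (M.particleKernel hg χ N n y) :=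
      (integrable_const _).add i1
    calc _ ≤ ∫ x, (2 * Real.exp (C ^ 2 * (3 * t) ^ 2 / 2)
            + Real.exp (3 * t * |M.predError χ y n f x|)
            + Real.exp (3 * t * (2 * C) * |M.predError χ y n w x|))
            ∂(M.particleKernel hg χ N n y) := by
          -- This form asks for integrability of the upper bound only, so the inner integral need
          -- not be shown measurable in `x`.
          refine integral_mono_of_nonneg
            (ae_of_all _ fun x => integral_nonneg fun x' => (Real.exp_pos _).le)
            (i0.add i2) (ae_of_all _ fun x => ?_)
          have := M.isProbabilityMeasure_mixture hg (y n) x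
          have hA := bddMeas_scaledError hh (∫ z, h z ∂(M.mixture (y n) x)) N
          have i3 : Integrable (fun x' => Real.exp (3 * t *
              |scaledError h (∫ z, h z ∂(M.mixture (y n) x)) x'|))
              (Measure.pi fun _ : Fin N => M.mixture (y n) x) :=
            ((BddMeas.const (3 * t)).mul hA.abs).exp.integrable _
          have i4 : Integrable (fun x' => Real.exp (3 * t *
              |scaledError h (∫ z, h z ∂(M.mixture (y n) x)) x'|)
              + Real.exp (3 * t * |M.predError χ y n f x|))
              (Measure.pi fun _ : Fin N => M.mixture (y n) x) := i3.add (integrable_const _)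
          have i5 := i4.add
            (integrable_const (Real.exp (3 * t * (2 * C) * |M.predError χ y n w x|)))
          calc _ ≤ ∫ x', (Real.exp (3 * t *
                    |scaledError h (∫ z, h z ∂(M.mixture (y n) x)) x'|)
                  + Real.exp (3 * t * |M.predError χ y n f x|)
                  + Real.exp (3 * t * (2 * C) * |M.predError χ y n w x|))
                  ∂(Measure.pi fun _ : Fin N => M.mixture (y n) x) := by
                refine integral_mono (((BddMeas.const t).mul hS.abs).exp.integrable _) i5
                  fun x' => ?_
                have h1 : |M.predError χ y (n + 1) h x'|
                    ≤ |scaledError h (∫ z, h z ∂(M.mixture (y n) x)) x'|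
                      + |M.predError χ y n f x| + 2 * C * |M.predError χ y n w x| := by
                  rw [M.predError_succ χ n h x x', add_assoc]
                  refine (abs_add_le _ _).trans (add_le_add le_rfl ?_)
                  exact M.abs_sqrt_mul_mixBias_le hb hg χ n hh hC x
                have h2 := exp_add_add_le
                  (t * |scaledError h (∫ z, h z ∂(M.mixture (y n) x)) x'|)
                  (t * |M.predError χ y n f x|) (t * (2 * C * |M.predError χ y n w x|))
                refine (Real.exp_le_exp.2 (mul_le_mul_of_nonneg_left h1 ht)).trans ?_
                rw [mul_add, mul_add]
                refine h2.trans_eq ?_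
                simp only [mul_assoc]
            _ ≤ _ := by
                rw [integral_add i4 (integrable_const _), integral_add i3 (integrable_const _)]
                simp only [integral_const, probReal_univ, one_smul]
                gcongr
                exact integral_exp_mul_abs_scaledError_le _ hh hC0 hC N (3 * t)
      _ ≤ _ := by
          rw [integral_add i0 i2, integral_add (integrable_const _) i1]
          simp only [integral_const, probReal_univ, one_smul]
          gcongr
          · exact hK₁ N
          · exact hK₂ N

-- Follows from the exponential moment with `t = 1`, since `u² ≤ 2 exp |u|`.
include hb in
lemma exists_integral_predError_sq_le (n : ℕ) {h : X → ℝ} (hh : BddMeas h) :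
    ∃ K, ∀ (N : ℕ) [NeZero N],
      ∫ x, M.predError χ y n h x * M.predError χ y n h x ∂(M.particleKernel hg χ N n y) ≤ K := by
  obtain ⟨K, hK⟩ := M.exists_integral_exp_predError_le hb hg χ n hh zero_le_one
  refine ⟨2 * K, fun N _ => ?_⟩
  have hS := M.bddMeas_predError (y := y) χ n hh N
  refine le_trans ?_ (mul_le_mul_of_nonneg_left (hK N) zero_le_two)
  rw [← integral_const_mul]
  refine integral_mono ((hS.mul hS).integrable _)
    ((((BddMeas.const 1).mul hS.abs).exp.integrable _).const_mul 2) fun x => ?_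
  have h1 := Real.quadratic_le_exp_of_nonneg (abs_nonneg (M.predError χ y n h x))
  rw [sq_abs] at h1
  simp only [one_mul]
  nlinarith [abs_nonneg (M.predError χ y n h x)]

include hb hg in
/-- One step of the particle system at the level of characteristic functions, conditionally on the
current particles. -/
lemma norm_integral_cexp_predError_mixture_sub_le (n : ℕ) {h : X → ℝ} (hh : BddMeas h) {C : ℝ}
    (hC0 : 0 ≤ C) (hC : ∀ x, |h x| ≤ C) {N : ℕ} [NeZero N] (x : Fin N → X) :
    ‖∫ x', Complex.exp (Complex.I * (M.predError χ y (n + 1) h x' : ℂ))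
          ∂(Measure.pi fun _ : Fin N => M.mixture (y n) x)
        - Complex.exp (Complex.I * (M.predError χ y n (M.pullback χ y n h) x : ℂ))
          * Complex.exp ((-(∫ x, (h x - ∫ z, h z ∂(M.predictor χ y (n + 1))) ^ 2
                ∂(M.predictor χ y (n + 1))) / 2 : ℝ) : ℂ)‖
      ≤ ((((2 * C) ^ 3 * Real.exp (2 * C) + 4 * C ^ 4 * Real.exp (2 * C ^ 2))
            + 1 / 2 + 3 * (C * C) + C)
          + (C + 1) * (M.predError χ y n (M.pullback χ y n h) x
            * M.predError χ y n (M.pullback χ y n h) x)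
          + (1 / 2) * (M.predError χ y n (M.pullback χ y n fun x => h x * h x) x
            * M.predError χ y n (M.pullback χ y n fun x => h x * h x) x)
          + (C * C + 2 * C * C + 1 + 2 * C) * (M.predError χ y n (M.normLik χ y n) x
            * M.predError χ y n (M.normLik χ y n) x)) / √(N : ℝ) := by
  have hh2 := hh.mul hh
  have hC2 (x : X) : |h x * h x| ≤ C * C := by
    rw [abs_mul]; exact mul_le_mul (hC x) (hC x) (abs_nonneg _) hC0
  have := M.isProbabilityMeasure_predictor hb χ hg (n + 1)
  set f := M.pullback χ y n h with hfdef
  set f2 := M.pullback χ y n (fun x => h x * h x)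
  set w := M.normLik χ y n
  set c := ∫ z, h z ∂(M.predictor χ y (n + 1)) with hc
  set v := ∫ x, (h x - c) ^ 2 ∂(M.predictor χ y (n + 1)) with hv
  set D := (2 * C) ^ 3 * Real.exp (2 * C) + 4 * C ^ 4 * Real.exp (2 * C ^ 2) with hD
  have hN : (0 : ℝ) < N := by exact_mod_cast NeZero.pos N
  have hsN : 0 < √(N : ℝ) := Real.sqrt_pos.2 hN
  have hnorm (u : ℝ) : ‖Complex.exp (Complex.I * (u : ℂ))‖ = 1 := by
    rw [mul_comm, Complex.norm_exp_ofReal_mul_I]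
  have hmix := M.isProbabilityMeasure_mixture hg (y n) x
  have hbias := M.abs_sqrt_mul_mixBias_le hb hg χ n hh hC x
  have hbias2 := M.abs_sqrt_mul_mixBias_le hb hg χ n hh2 hC2 x
  have hdec := M.sqrt_mul_mixBias hb hg χ n hh x
  have hchar := norm_integral_cexp_scaledError_sub_le (M.mixture (y n) x) hh hC0 hC N
  set m := ∫ z, h z ∂(M.mixture (y n) x) with hm
  set vx := ∫ z, (h z - m) ^ 2 ∂(M.mixture (y n) x) with hvx
  set r := M.mixBias χ y n h x with hr
  set r2 := M.mixBias χ y n (fun x => h x * h x) x with hr2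
  set a := M.predError χ y n f x
  set a2 := M.predError χ y n f2 x
  set b := M.predError χ y n w x
  have hrm : r = m - c := rfl
  have hvdiff : vx - v = r2 - r * (m + c) := by
    rw [hvx, hv, hm, integral_sub_sq_eq _ hh, hc, integral_sub_sq_eq _ hh, ← hc, ← hm, hr2, hrm,
      mixBias]
    ring
  have hmC : |m| ≤ C := abs_integral_le_of_bound _ hC
  have hcC : |c| ≤ C := abs_integral_le_of_bound _ hC
  have hJ : ∫ x', Complex.exp (Complex.I * (M.predError χ y (n + 1) h x' : ℂ))
        ∂(Measure.pi fun _ : Fin N => M.mixture (y n) x)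
      = Complex.exp (Complex.I * ((√(N : ℝ) * r : ℝ) : ℂ)) *
        ∫ x', Complex.exp (Complex.I * (scaledError h m x' : ℂ))
        ∂(Measure.pi fun _ : Fin N => M.mixture (y n) x) := by
    rw [← integral_const_mul]
    refine integral_congr_ae (ae_of_all _ fun x' => ?_)
    simp only
    rw [M.predError_succ χ n h x x', ← Complex.exp_add]
    congr 1
    push_cast
    ring
  rw [hJ]
  set I₀ := ∫ x', Complex.exp (Complex.I * (scaledError h m x' : ℂ))
        ∂(Measure.pi fun _ : Fin N => M.mixture (y n) x)
  -- Three successive replacements: the i.i.d. characteristic function by a Gaussian one, the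
  -- mixture variance by the predictor variance, the scaled bias by the error of `pullback`.
  have hsplit : Complex.exp (Complex.I * ((√(N : ℝ) * r : ℝ) : ℂ)) * I₀
      - Complex.exp (Complex.I * (a : ℂ)) * Complex.exp ((-v / 2 : ℝ) : ℂ)
      = Complex.exp (Complex.I * ((√(N : ℝ) * r : ℝ) : ℂ)) *
          (I₀ - Complex.exp ((-vx / 2 : ℝ) : ℂ))
        + Complex.exp (Complex.I * ((√(N : ℝ) * r : ℝ) : ℂ)) *
          (Complex.exp ((-vx / 2 : ℝ) : ℂ) - Complex.exp ((-v / 2 : ℝ) : ℂ))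
        + (Complex.exp (Complex.I * ((√(N : ℝ) * r : ℝ) : ℂ)) - Complex.exp (Complex.I * (a : ℂ)))
          * Complex.exp ((-v / 2 : ℝ) : ℂ) := by ring
  have hvx0 : 0 ≤ vx := integral_nonneg fun z => sq_nonneg _
  have hv0 : 0 ≤ v := integral_nonneg fun z => sq_nonneg _
  have hexp : ‖Complex.exp ((-vx / 2 : ℝ) : ℂ) - Complex.exp ((-v / 2 : ℝ) : ℂ)‖
      ≤ |vx - v| / 2 := by
    rw [← Complex.ofReal_exp, ← Complex.ofReal_exp, ← Complex.ofReal_sub, Complex.norm_real]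
    exact abs_exp_neg_half_sub_le hvx0 hv0
  have hexp1 : ‖Complex.exp ((-v / 2 : ℝ) : ℂ)‖ ≤ 1 := by
    rw [Complex.norm_exp_ofReal]
    exact Real.exp_le_one_iff.2 (by linarith)
  have hlast := norm_cexp_I_mul_sub_le (√(N : ℝ) * r) a
  have hbound : ‖Complex.exp (Complex.I * ((√(N : ℝ) * r : ℝ) : ℂ)) * I₀
      - Complex.exp (Complex.I * (a : ℂ)) * Complex.exp ((-v / 2 : ℝ) : ℂ)‖
      ≤ D / √(N : ℝ) + |vx - v| / 2 + |√(N : ℝ) * r - a| := by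
    rw [hsplit]
    refine (norm_add₃_le).trans ?_
    rw [norm_mul, norm_mul, norm_mul, hnorm, one_mul, one_mul]
    refine add_le_add (add_le_add hchar hexp) ?_
    exact (mul_le_mul hlast hexp1 (norm_nonneg _) (abs_nonneg _)).trans_eq (mul_one _)
  refine hbound.trans ?_
  rw [le_div_iff₀ hsN, add_mul, add_mul, div_mul_cancel₀ _ hsN.ne']
  rw [abs_mul, abs_of_pos hsN] at hbias hbias2
  have e1 : |vx - v| ≤ |r2| + |r| * (2 * C) := by
    rw [hvdiff]
    refine (abs_sub _ _).trans ?_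
    rw [abs_mul]
    gcongr
    exact (abs_add_le _ _).trans (by linarith)
  have e2 : |√(N : ℝ) * r - a| * √(N : ℝ) = √(N : ℝ) * |r| * |b| := by
    have h1 : √(N : ℝ) * r - a = -(r * b) := by rw [hdec]; ring
    rw [h1, abs_neg, abs_mul]
    ring
  rw [e2]
  exact remainder_le hC0 hsN hbias hbias2 e1

include hb in
/-- One step of the induction for the characteristic function of the scaled errors. -/
lemma exists_norm_integral_cexp_predError_succ_sub_le (n : ℕ) {h : X → ℝ} (hh : BddMeas h) :
    ∃ K, ∀ (N : ℕ) [NeZero N],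
      ‖∫ x, Complex.exp (Complex.I * (M.predError χ y (n + 1) h x : ℂ))
            ∂(M.particleKernel hg χ N (n + 1) y)
          - (∫ x, Complex.exp (Complex.I * (M.predError χ y n (M.pullback χ y n h) x : ℂ))
              ∂(M.particleKernel hg χ N n y))
            * Complex.exp ((-(∫ x, (h x - ∫ z, h z ∂(M.predictor χ y (n + 1))) ^ 2
                ∂(M.predictor χ y (n + 1))) / 2 : ℝ) : ℂ)‖ ≤ K / √(N : ℝ) := by
  obtain ⟨C, hC0, hC⟩ := hh.exists_bound
  have hh2 := hh.mul hh
  have hf := M.bddMeas_pullback hb χ n hh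
  have hf2 := M.bddMeas_pullback hb χ n hh2
  have hw := M.bddMeas_normLik hb χ n
  obtain ⟨K₁, hK₁⟩ := M.exists_integral_predError_sq_le hb hg χ n hf
  obtain ⟨K₂, hK₂⟩ := M.exists_integral_predError_sq_le hb hg χ n hf2
  obtain ⟨K₃, hK₃⟩ := M.exists_integral_predError_sq_le hb hg χ n hw
  have := M.isProbabilityMeasure_predictor hb χ hg (n + 1)
  set f := M.pullback χ y n h with hfdef
  set f2 := M.pullback χ y n (fun x => h x * h x)
  set w := M.normLik χ y n
  set c := ∫ z, h z ∂(M.predictor χ y (n + 1)) with hc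
  set v := ∫ x, (h x - c) ^ 2 ∂(M.predictor χ y (n + 1)) with hv
  set D := (2 * C) ^ 3 * Real.exp (2 * C) + 4 * C ^ 4 * Real.exp (2 * C ^ 2) with hD
  refine ⟨(D + 1 / 2 + 3 * (C * C) + C) + (C + 1) * K₁ + (1 / 2) * K₂
    + (C * C + 2 * C * C + 1 + 2 * C) * K₃, fun N _ => ?_⟩
  have hcexp {Z : Type _} [MeasurableSpace Z] {u : Z → ℝ} (hu : Measurable u) :
      StronglyMeasurable fun z => Complex.exp (Complex.I * (u z : ℂ)) :=
    Measurable.stronglyMeasurable (by fun_prop)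
  have hnorm (u : ℝ) : ‖Complex.exp (Complex.I * (u : ℂ))‖ = 1 := by
    rw [mul_comm, Complex.norm_exp_ofReal_mul_I]
  have hS := M.bddMeas_predError (y := y) χ (n + 1) hh N
  have hSf := M.bddMeas_predError (y := y) χ n hf N
  have hSf2 := M.bddMeas_predError (y := y) χ n hf2 N
  have hSw := M.bddMeas_predError (y := y) χ n hw N
  have iS : Integrable (fun x => Complex.exp (Complex.I * (M.predError χ y (n + 1) h x : ℂ)))
      (M.particleKernel hg χ N (n + 1) y) :=
    Integrable.of_bound (hcexp hS.measurable).aestronglyMeasurable 1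
      (ae_of_all _ fun x => (hnorm _).le)
  rw [M.integral_particleKernel_succ hg χ N n y iS, ← integral_mul_const, ← integral_sub]
  rotate_left
  -- Measurability in `x` comes from viewing the product of mixtures as `mutation` at the frozen
  -- observation `y n`.
  · have hm : StronglyMeasurable fun x : Fin N → X =>
        ∫ x', Complex.exp (Complex.I * (M.predError χ y (n + 1) h x' : ℂ))
          ∂((M.mutation hg N).comap (fun x => (y n, x)) (by fun_prop) x) :=
      (hcexp hS.measurable).integral_kernel
    refine Integrable.of_bound hm.aestronglyMeasurable 1 (ae_of_all _ fun x => ?_)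
    have := M.isProbabilityMeasure_mixture hg (y n) x
    have := norm_integral_le_of_norm_le_const
      (μ := Measure.pi fun _ : Fin N => M.mixture (y n) x)
      (f := fun x' => Complex.exp (Complex.I * (M.predError χ y (n + 1) h x' : ℂ))) (C := 1)
      (ae_of_all _ fun x => (hnorm _).le)
    simpa using this
  · exact (Integrable.of_bound (hcexp hSf.measurable).aestronglyMeasurable 1
      (ae_of_all _ fun x => (hnorm _).le)).mul_const _
  have i1 := (hSf.mul hSf).integrable (M.particleKernel hg χ N n y)
  have i2 := (hSf2.mul hSf2).integrable (M.particleKernel hg χ N n y)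
  have i3 := (hSw.mul hSw).integrable (M.particleKernel hg χ N n y)
  have iW1 : Integrable (fun x => (D + 1 / 2 + 3 * (C * C) + C)
      + (C + 1) * (M.predError χ y n f x * M.predError χ y n f x))
      (M.particleKernel hg χ N n y) := (integrable_const _).add (i1.const_mul _)
  have iW2 : Integrable (fun x => (D + 1 / 2 + 3 * (C * C) + C)
      + (C + 1) * (M.predError χ y n f x * M.predError χ y n f x)
      + (1 / 2) * (M.predError χ y n f2 x * M.predError χ y n f2 x))
      (M.particleKernel hg χ N n y) := iW1.add (i2.const_mul _)
  have iW3 : Integrable (fun x => (D + 1 / 2 + 3 * (C * C) + C)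
      + (C + 1) * (M.predError χ y n f x * M.predError χ y n f x)
      + (1 / 2) * (M.predError χ y n f2 x * M.predError χ y n f2 x)
      + (C * C + 2 * C * C + 1 + 2 * C) * (M.predError χ y n w x * M.predError χ y n w x))
      (M.particleKernel hg χ N n y) := iW2.add (i3.const_mul _)
  refine (norm_integral_le_of_norm_le (iW3.div_const (√(N : ℝ))) (ae_of_all _ fun x => ?_)).trans ?_
  swap
  · rw [integral_div, integral_add iW2 (i3.const_mul _), integral_add iW1 (i2.const_mul _),
      integral_add (integrable_const _) (i1.const_mul _), integral_const_mul, integral_const_mul,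
      integral_const_mul]
    simp only [integral_const, probReal_univ, one_smul]
    gcongr
    · exact hK₁ N
    · exact hK₂ N
    · exact hK₃ N
  exact M.norm_integral_cexp_predError_mixture_sub_le hb hg χ n hh hC0 hC x

include hb in
/-- Convergence of the characteristic functions of the scaled errors. -/
theorem tendsto_integral_cexp_predError (n : ℕ) {h : X → ℝ} (hh : BddMeas h) :
    Tendsto (fun N : ℕ => ∫ x, Complex.exp (Complex.I * (M.predError χ y n h x : ℂ))
        ∂(M.particleKernel hg χ (N + 1) n y)) atTop
      (𝓝 (Complex.exp ((-(M.asympVar χ y n h) / 2 : ℝ) : ℂ))) := by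
  have hlim (K : ℝ) : Tendsto (fun N : ℕ => K / √((N + 1 : ℕ) : ℝ)) atTop (𝓝 0) :=
    ((Real.tendsto_sqrt_atTop.comp tendsto_natCast_atTop_atTop).comp
      (tendsto_add_atTop_nat 1)).const_div_atTop K
  induction n generalizing h with
  | zero =>
    obtain ⟨C, hC0, hC⟩ := hh.exists_bound
    rw [tendsto_iff_norm_sub_tendsto_zero]
    refine squeeze_zero (fun _ => norm_nonneg _) (fun N => ?_)
      (hlim ((2 * C) ^ 3 * Real.exp (2 * C) + 4 * C ^ 4 * Real.exp (2 * C ^ 2)))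
    rw [M.asympVar_zero χ hh]
    simp only [predError, predictor_zero, particleKernel_zero_apply]
    exact norm_integral_cexp_scaledError_sub_le χ hh hC0 hC (N + 1)
  | succ n ih =>
    obtain ⟨K, hK⟩ := M.exists_norm_integral_cexp_predError_succ_sub_le hb hg χ n hh
    have h1 := (ih (M.bddMeas_pullback hb χ n hh)).mul_const
      (Complex.exp ((-(∫ x, (h x - ∫ z, h z ∂(M.predictor χ y (n + 1))) ^ 2
                ∂(M.predictor χ y (n + 1))) / 2 : ℝ) : ℂ))
    have h2 := (squeeze_zero_norm (fun N : ℕ => hK (N + 1)) (hlim K)).add h1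
    simp only [sub_add_cancel, zero_add] at h2
    rw [← Complex.exp_add, ← Complex.ofReal_add] at h2
    convert! h2 using 4
    rw [M.asympVar_succ hb χ hg n hh]
    ring

end HMM

/-! ### From weak convergence to absolute moments; Gaussian moments. -/

section Moments

lemma exists_abs_rpow_le_mul_exp {q : ℝ} (hq : 0 ≤ q) :
    ∃ C, 0 ≤ C ∧ ∀ x : ℝ, |x| ^ q ≤ C * Real.exp |x| := by
  obtain ⟨k, hk⟩ := exists_nat_ge q
  refine ⟨1 + k.factorial, by positivity, fun x => ?_⟩
  have h0 : (0 : ℝ) < k.factorial := by exact_mod_cast k.factorial_pos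
  have h1 : |x| ^ k ≤ k.factorial * Real.exp |x| := by
    have := Real.pow_div_factorial_le_exp |x| (abs_nonneg x) k
    rwa [div_le_iff₀' h0] at this
  have h2 : (1 : ℝ) ≤ Real.exp |x| := Real.one_le_exp (abs_nonneg x)
  have h3 := pow_nonneg (abs_nonneg x) k
  rw [add_mul, one_mul]
  rcases le_total |x| 1 with hx | hx
  · have : |x| ^ q ≤ 1 := Real.rpow_le_one (abs_nonneg _) hx hq
    linarith
  · have : |x| ^ q ≤ |x| ^ (k : ℝ) := Real.rpow_le_rpow_of_exponent_le hx hk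
    rw [Real.rpow_natCast] at this
    linarith

/-- The truncated absolute power, as a bounded continuous function. -/
def truncRpow (p A : ℝ) (hp : 0 < p) (hA : 0 ≤ A) : BoundedContinuousFunction ℝ ℝ :=
  BoundedContinuousFunction.ofNormedAddCommGroup (fun x => min (|x| ^ p) A)
    ((continuous_abs.rpow_const fun _ => Or.inr hp.le).min continuous_const) A fun x => by
      rw [Real.norm_eq_abs, abs_of_nonneg (le_min (Real.rpow_nonneg (abs_nonneg _) _) hA)]
      exact min_le_right _ _

lemma integrable_abs_rpow_of_integrable_exp {μ : Measure ℝ} {q : ℝ} (hq : 0 ≤ q)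
    (hi : Integrable (fun x => Real.exp |x|) μ) : Integrable (fun x => |x| ^ q) μ := by
  obtain ⟨C, -, hC⟩ := exists_abs_rpow_le_mul_exp hq
  refine (hi.const_mul C).mono' (by fun_prop) (ae_of_all _ fun x => ?_)
  rw [Real.norm_eq_abs, abs_of_nonneg (Real.rpow_nonneg (abs_nonneg _) _)]
  exact hC x

/-- Where `|x|^p` exceeds `A` it is at most `|x|^(2p) / A`. The truncation error thus depends on `μ`
only through its exponential moment. -/
lemma abs_integral_rpow_sub_trunc_le {μ : Measure ℝ} [IsProbabilityMeasure μ] {p A C K : ℝ}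
    (hp : 0 < p) (hA : 0 < A) (hC0 : 0 ≤ C) (hC : ∀ x : ℝ, |x| ^ (2 * p) ≤ C * Real.exp |x|)
    (hi : Integrable (fun x => Real.exp |x|) μ) (hK : ∫ x, Real.exp |x| ∂μ ≤ K) :
    |∫ x, |x| ^ p ∂μ - ∫ x, truncRpow p A hp hA.le x ∂μ| ≤ C * K / A := by
  have i1 := integrable_abs_rpow_of_integrable_exp hp.le hi
  have i2 : Integrable (fun x => truncRpow p A hp hA.le x) μ :=
    BoundedContinuousFunction.integrable μ _
  rw [← integral_sub i1 i2]
  have h1 := norm_integral_le_of_norm_le ((hi.const_mul C).div_const A)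
    (f := fun x => |x| ^ p - truncRpow p A hp hA.le x) (ae_of_all _ fun x => ?_)
  · refine h1.trans ?_
    rw [integral_div, integral_const_mul]
    gcongr
  · have h2 : truncRpow p A hp hA.le x = min (|x| ^ p) A := rfl
    have h3 : 0 ≤ |x| ^ p := Real.rpow_nonneg (abs_nonneg _) _
    have h4 : |x| ^ (2 * p) = |x| ^ p * |x| ^ p := by
      rw [two_mul, Real.rpow_add_of_nonneg (abs_nonneg _) hp.le hp.le]
    rw [h2, Real.norm_eq_abs, abs_of_nonneg (by linarith [min_le_left (|x| ^ p) A]),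
      le_div_iff₀ hA]
    refine le_trans ?_ (hC x)
    rw [h4]
    rcases le_total (|x| ^ p) A with h | h
    · rw [min_eq_left h]
      simp only [sub_self, zero_mul]
      positivity
    · rw [min_eq_right h]
      nlinarith

/-- Weak convergence together with bounded exponential moments implies the convergence of absolute
moments. -/
lemma tendsto_integral_abs_rpow {μ : ℕ → ProbabilityMeasure ℝ} {μ₀ : ProbabilityMeasure ℝ}
    (hμ : Tendsto μ atTop (𝓝 μ₀)) {K : ℝ}
    (hi : ∀ N, Integrable (fun x => Real.exp |x|) (μ N : Measure ℝ))
    (hK : ∀ N, ∫ x, Real.exp |x| ∂(μ N : Measure ℝ) ≤ K)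
    (hi₀ : Integrable (fun x => Real.exp |x|) (μ₀ : Measure ℝ)) {p : ℝ} (hp : 0 < p) :
    Tendsto (fun N => ∫ x, |x| ^ p ∂(μ N : Measure ℝ)) atTop
      (𝓝 (∫ x, |x| ^ p ∂(μ₀ : Measure ℝ))) := by
  obtain ⟨C, hC0, hC⟩ := exists_abs_rpow_le_mul_exp (q := 2 * p) (by positivity)
  set K' := max K (∫ x, Real.exp |x| ∂(μ₀ : Measure ℝ)) with hK'
  have hK'0 : 0 ≤ K' := le_max_of_le_right (integral_nonneg fun x => (Real.exp_pos _).le)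
  rw [Metric.tendsto_atTop]
  intro ε hε
  -- The level makes both truncation errors smaller than `ε / 3`; the `+ 1` keeps `A` positive when
  -- `C * K' = 0`.
  set A := 3 * (C * K' + 1) / ε with hA
  have hA0 : 0 < A := by positivity
  have hAε : C * K' / A < ε / 3 := by
    rw [hA, div_lt_iff₀ (by positivity)]
    field_simp
    linarith
  have h1 := (ProbabilityMeasure.tendsto_iff_forall_integral_tendsto.1 hμ)
    (truncRpow p A hp hA0.le)
  obtain ⟨N₀, hN₀⟩ := (Metric.tendsto_atTop.1 h1) (ε / 3) (by positivity)
  refine ⟨N₀, fun N hN => ?_⟩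
  have h2 := hN₀ N hN
  have h3 := abs_integral_rpow_sub_trunc_le hp hA0 hC0 hC (hi N) 
    ((hK N).trans (le_max_left K (∫ x, Real.exp |x| ∂(μ₀ : Measure ℝ))))
  have h4 := abs_integral_rpow_sub_trunc_le hp hA0 hC0 hC hi₀ (le_max_right K _)
  rw [← hK'] at h3 h4
  rw [Real.dist_eq] at h2 ⊢
  rw [abs_le] at h3 h4
  rw [abs_lt] at h2 ⊢
  constructor <;> linarith [h2.1, h2.2, h3.1, h3.2, h4.1, h4.2]

lemma integrable_exp_abs_gaussianReal (v : NNReal) :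
    Integrable (fun x => Real.exp |x|) (gaussianReal 0 v) := by
  refine ((integrable_exp_mul_gaussianReal (μ := 0) (v := v) 1).add
    (integrable_exp_mul_gaussianReal (μ := 0) (v := v) (-1))).mono'
    (by fun_prop) (ae_of_all _ fun x => ?_)
  rw [Real.norm_eq_abs, abs_of_pos (Real.exp_pos _)]
  simpa using exp_mul_abs_le 1 x

/-- The absolute moments of the standard normal law. -/
lemma integral_abs_rpow_gaussianReal {p : ℝ} (hp : 0 < p) :
    ∫ z, |z| ^ p ∂(gaussianReal 0 1) = 2 ^ (p / 2) * (Real.Gamma ((p + 1) / 2) / √Real.pi) := by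
  rw [integral_gaussianReal_eq_integral_smul one_ne_zero]
  -- As a function of `|x|`, the integrand folds onto the half-line, where its integral is a Gamma
  -- integral.
  have h1 : (fun x : ℝ => gaussianPDFReal 0 1 x • |x| ^ p)
      = fun x => (fun u : ℝ => (√(2 * Real.pi))⁻¹ *
        (u ^ p * Real.exp (-(1 / 2) * u ^ (2 : ℝ)))) |x| := by
    ext x
    simp only [gaussianPDFReal, smul_eq_mul, Real.rpow_two, sq_abs, sub_zero, NNReal.coe_one,
      mul_one]
    ring_nf
  rw [h1, integral_comp_abs (f := fun u : ℝ => (√(2 * Real.pi))⁻¹ *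
      (u ^ p * Real.exp (-(1 / 2) * u ^ (2 : ℝ)))), integral_const_mul,
    integral_rpow_mul_exp_neg_mul_rpow two_pos (by linarith) (by norm_num)]
  have h2 : ((1 / 2 : ℝ)) ^ (-(p + 1) / 2) = 2 ^ (p / 2) * √2 := by
    rw [one_div, Real.inv_rpow zero_le_two, ← Real.rpow_neg zero_le_two, Real.sqrt_eq_rpow,
      ← Real.rpow_add two_pos]
    congr 1
    ring
  rw [h2, Real.sqrt_mul zero_le_two]
  have := Real.sqrt_pos.2 Real.pi_pos
  field_simp

lemma integral_abs_mul_rpow_gaussianReal {s p : ℝ} (hs : 0 ≤ s) (hp : 0 < p) :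
    √2 * s * (Real.Gamma ((p + 1) / 2) / √Real.pi) ^ (1 / p)
      = (∫ z, |s * z| ^ p ∂(gaussianReal 0 1)) ^ (1 / p) := by
  have h1 (z : ℝ) : |s * z| ^ p = s ^ p * |z| ^ p := by
    rw [abs_mul, abs_of_nonneg hs, Real.mul_rpow hs (abs_nonneg _)]
  simp_rw [h1]
  have hG : 0 ≤ Real.Gamma ((p + 1) / 2) / √Real.pi :=
    div_nonneg (Real.Gamma_pos_of_pos (by positivity)).le (Real.sqrt_nonneg _)
  rw [integral_const_mul, integral_abs_rpow_gaussianReal hp,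
    Real.mul_rpow (by positivity) (by positivity), Real.mul_rpow (by positivity) hG,
    ← Real.rpow_mul hs, ← Real.rpow_mul zero_le_two, mul_one_div_cancel hp.ne', Real.rpow_one,
    Real.sqrt_eq_rpow]
  have : p / 2 * (1 / p) = 1 / 2 := by field_simp
  rw [this]
  ring

end Moments

/-! ### The limit for a fixed observation sequence. -/

namespace HMM

variable {X Y : Type*} [MeasurableSpace X] [MeasurableSpace Y] (M : HMM X Y)
  {y : ℕ → Y} (hb : ∀ k, ∃ B, ∀ x, M.g x (y k) ≤ B) (hg : ∀ x y, 0 < M.g x y)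
  (χ : Measure X)

/-- By linearity in the test function, the characteristic function at `t` for `h` is the one at `1`
for `t * h`; hence the induction treats only argument `1`. -/
lemma predError_const_mul (n : ℕ) (h : X → ℝ) (t : ℝ) {N : ℕ} (x : Fin N → X) :
    M.predError χ y n (fun z => t * h z) x = t * M.predError χ y n h x := by
  simp only [predError, scaledError, empMean, integral_const_mul, ← Finset.mul_sum]
  ring

lemma asympVar_const_mul (n : ℕ) (h : X → ℝ) (t : ℝ) :
    M.asympVar χ y n (fun z => t * h z) = t ^ 2 * M.asympVar χ y n h := by
  simp only [asympVar, integral_const_mul, Finset.mul_sum]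
  refine Finset.sum_congr rfl fun k _ => ?_
  rw [← integral_const_mul (t ^ 2)]
  refine integral_congr_ae (ae_of_all _ fun x => ?_)
  simp only
  rw [← mul_pow]
  congr 1
  ring

variable [IsProbabilityMeasure χ]

include hb in
theorem tendsto_integral_abs_predError_rpow (n : ℕ) {h : X → ℝ} (hh : BddMeas h) {p : ℝ}
    (hp : 0 < p) :
    Tendsto (fun N : ℕ => ∫ x, |M.predError χ y n h x| ^ p
        ∂(M.particleKernel hg χ (N + 1) n y)) atTop
      (𝓝 (∫ z, |M.asympStd χ y n h * z| ^ p ∂(gaussianReal 0 1))) := by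
  have hm : Measurable fun x : ℝ => |x| ^ p := by fun_prop
  have hS (N : ℕ) := M.bddMeas_predError (y := y) χ n hh (N + 1)
  have hSm (N : ℕ) : AEMeasurable (fun x => M.predError χ y n h x)
    (M.particleKernel hg χ (N + 1) n y) := (hS N).measurable.aemeasurable
  set v : NNReal := ⟨M.asympVar χ y n h, M.asympVar_nonneg χ n h⟩
  have hv : (v : ℝ) = M.asympVar χ y n h := rfl
  let μ : ℕ → ProbabilityMeasure ℝ := fun N =>
    ⟨(M.particleKernel hg χ (N + 1) n y).map fun x => M.predError χ y n h x,
      Measure.isProbabilityMeasure_map (hSm N)⟩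
  let μ₀ : ProbabilityMeasure ℝ := ⟨gaussianReal 0 v, inferInstance⟩
  have hμ : Tendsto μ atTop (𝓝 μ₀) := by
    refine ProbabilityMeasure.tendsto_of_tendsto_charFun fun t => ?_
    have h1 := M.tendsto_integral_cexp_predError hb hg χ n ((BddMeas.const t).mul hh)
    have h2 : charFun (μ₀ : Measure ℝ) t
        = Complex.exp ((-(M.asympVar χ y n fun z => t * h z) / 2 : ℝ) : ℂ) := by
      rw [M.asympVar_const_mul]
      change charFun (gaussianReal 0 v) t = _
      rw [charFun_gaussianReal]
      congr 1
      have hv' : ((v : ℝ) : ℂ) = (M.asympVar χ y n h : ℂ) := rfl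
      simp only [hv', Complex.ofReal_zero, mul_zero, zero_mul, zero_sub]
      push_cast
      ring
    rw [h2]
    refine h1.congr fun N => ?_
    rw [charFun_apply_real]
    change _ = ∫ x, Complex.exp (t * x * Complex.I)
      ∂((M.particleKernel hg χ (N + 1) n y).map fun x => M.predError χ y n h x)
    rw [integral_map (hSm N) (by fun_prop)]
    refine integral_congr_ae (ae_of_all _ fun x => ?_)
    simp only
    rw [predError_const_mul]
    congr 1
    push_cast
    ring
  obtain ⟨K, hK⟩ := M.exists_integral_exp_predError_le hb hg χ n hh zero_le_one
  have h3 := tendsto_integral_abs_rpow hμ (K := K) (fun N => ?_) (fun N => ?_)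
    (integrable_exp_abs_gaussianReal v) hp
  · have h4 : ∫ x, |x| ^ p ∂(μ₀ : Measure ℝ)
        = ∫ z, |M.asympStd χ y n h * z| ^ p ∂(gaussianReal 0 1) := by
      have h5 : gaussianReal 0 v = (gaussianReal 0 1).map (M.asympStd χ y n h * ·) := by
        rw [gaussianReal_map_const_mul]
        congr 1
        · simp
        · ext
          simp [hv, asympStd, Real.sq_sqrt (M.asympVar_nonneg χ n h)]
      change ∫ x, |x| ^ p ∂(gaussianReal 0 v) = _
      rw [h5, integral_map (by fun_prop) hm.aestronglyMeasurable]
    rw [h4] at h3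
    refine h3.congr fun N => ?_
    exact integral_map (hSm N) hm.aestronglyMeasurable
  · change Integrable _ ((M.particleKernel hg χ (N + 1) n y).map _)
    rw [integrable_map_measure (by fun_prop) (hSm N)]
    exact (hS N).abs.exp.integrable _
  · change ∫ x, _ ∂((M.particleKernel hg χ (N + 1) n y).map _) ≤ _
    rw [integral_map (hSm N) (by fun_prop)]
    simpa using hK (N + 1)

include hb in
/-- The convergence of the scaled `L^p` errors of the particle filter for a fixed sequence of
observations. -/
theorem tendsto_sqrt_mul_integral_rpow (n : ℕ) {h : X → ℝ} (hh : BddMeas h) {p : ℝ}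
    (hp : 0 < p) :
    Tendsto (fun N : ℕ => √((N + 1 : ℕ) : ℝ) *
        (∫ x, |empMean h x - ∫ z, h z ∂(M.predictor χ y n)| ^ p
          ∂(M.particleKernel hg χ (N + 1) n y)) ^ (1 / p)) atTop
      (𝓝 (√2 * M.asympStd χ y n h * (Real.Gamma ((p + 1) / 2) / √Real.pi) ^ (1 / p))) := by
  rw [integral_abs_mul_rpow_gaussianReal (s := M.asympStd χ y n h) (Real.sqrt_nonneg _) hp]
  refine ((M.tendsto_integral_abs_predError_rpow hb hg χ n hh hp).rpow_const
    (Or.inr (by positivity))).congr fun N => ?_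
  have h1 (x : Fin (N + 1) → X) : |M.predError χ y n h x| ^ p
      = √((N + 1 : ℕ) : ℝ) ^ p * |empMean h x - ∫ z, h z ∂(M.predictor χ y n)| ^ p := by
    rw [predError, scaledError, abs_mul, abs_of_nonneg (Real.sqrt_nonneg _),
      Real.mul_rpow (Real.sqrt_nonneg _) (abs_nonneg _)]
  simp_rw [h1]
  rw [integral_const_mul, Real.mul_rpow (by positivity)
    (integral_nonneg fun x => Real.rpow_nonneg (abs_nonneg _) _),
    ← Real.rpow_mul (Real.sqrt_nonneg _), mul_one_div_cancel hp.ne', Real.rpow_one]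

end HMM

/-! ### Identification of the conditional law of the particles. -/

lemma measureReal_inter_eq_setIntegral_of_condExp {Ω : Type*} {m m₀ : MeasurableSpace Ω} {P : @Measure Ω m₀}
    [IsProbabilityMeasure P] (hm : m ≤ m₀) {S D : Set Ω} {u : Ω → ℝ} (hS : MeasurableSet[m₀] S)
    (hD : MeasurableSet[m] D) (hu : P⟦S | m⟧ =ᵐ[P] u) : P.real (S ∩ D) = ∫ ω in D, u ω ∂P := by
  rw [← setIntegral_congr_ae (hm _ hD) (hu.mono fun ω h _ => h),
    setIntegral_condExp hm ((integrable_const _).indicator hS) hD, integral_indicator hS,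
    Measure.restrict_restrict hS]
  simp

namespace HMM

variable {X Y : Type*} [MeasurableSpace X] [MeasurableSpace Y] (M : HMM X Y)

section Measurability

variable (χ : Measure X)

/-- The one-step kernel at time `n`, jointly in the observations and the state. -/
def jointStep (n : ℕ) : Kernel ((ℕ → Y) × X) X :=
  Kernel.withDensity (M.Q.comap (Prod.snd : (ℕ → Y) × X → X) measurable_snd)
    (fun p _ => ENNReal.ofReal (M.g p.2 (p.1 n)))

instance (n : ℕ) : IsSFiniteKernel (M.jointStep n) :=
  Kernel.IsSFiniteKernel.withDensity _ fun _ _ => ENNReal.ofReal_ne_top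

lemma jointStep_apply (n : ℕ) (p : (ℕ → Y) × X) : M.jointStep n p = M.step (p.1 n) p.2 := by
  rw [step_apply, jointStep, Kernel.withDensity_apply _ (by
    exact ENNReal.measurable_ofReal.comp (M.measurable_g_comp (by fun_prop) (by fun_prop))),
    withDensity_const, Kernel.comap_apply]

/-- The unnormalized predictor as a kernel in the observations. -/
def unnormPredictor : ℕ → Kernel (ℕ → Y) X
  | 0 => Kernel.const _ χ
  | n + 1 => Kernel.snd (unnormPredictor n ⊗ₖ M.jointStep n)

instance [SFinite χ] (n : ℕ) : IsSFiniteKernel (M.unnormPredictor χ n) := by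
  induction n with
  | zero => rw [unnormPredictor]; infer_instance
  | succ n ih => rw [unnormPredictor]; infer_instance

lemma unnormPredictor_apply [SFinite χ] (n : ℕ) (y : ℕ → Y) :
    M.unnormPredictor χ n y = M.L y 0 n ∘ₘ χ := by
  induction n with
  | zero => simp [unnormPredictor, L_zero]
  | succ n ih =>
    ext A hA
    rw [L_comp_succ, ← ih, Measure.bind_apply hA (Kernel.aemeasurable _), unnormPredictor,
      Kernel.snd_apply' _ _ hA, Kernel.compProd_apply (measurable_snd hA)]
    refine lintegral_congr fun x => ?_
    rw [jointStep_apply]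
    rfl

/-- The kernels `L y 0 n` are defined separately for each `y`; measurability in `y` is read off
`unnormPredictor`, a kernel from the observations. -/
lemma measurable_integral_predictor [SFinite χ] (n : ℕ) {h : X → ℝ} (hh : Measurable h) :
    Measurable fun y : ℕ → Y => ∫ x, h x ∂(M.predictor χ y n) := by
  simp_rw [M.integral_predictor χ, ← M.unnormPredictor_apply χ]
  exact (hh.stronglyMeasurable.integral_kernel.measurable).div
    (stronglyMeasurable_const.integral_kernel.measurable)

lemma L_congr (n : ℕ) {y y' : ℕ → Y} (hy : ∀ k < n, y k = y' k) : M.L y 0 n = M.L y' 0 n := by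
  induction n with
  | zero => rfl
  | succ n ih => rw [L, L, ih fun k hk => hy k (by omega), hy (0 + n) (by omega)]

lemma predictor_congr (n : ℕ) {y y' : ℕ → Y} (hy : ∀ k < n, y k = y' k) :
    M.predictor χ y n = M.predictor χ y' n := by
  rw [predictor, predictor, M.L_congr n hy]

/-- Holds for every `y`, including those where the normalizing mass is infinite and the predictor
need not be a probability. It provides bounds valid everywhere, not just almost surely. -/
lemma predictor_univ_le_one (n : ℕ) (y : ℕ → Y) : M.predictor χ y n Set.univ ≤ 1 := by
  rw [predictor, Measure.smul_apply, smul_eq_mul]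
  exact ENNReal.inv_mul_le_one _

lemma abs_integral_predictor_le (n : ℕ) (y : ℕ → Y) {h : X → ℝ} {C : ℝ} (hC0 : 0 ≤ C)
    (hC : ∀ x, |h x| ≤ C) : |∫ x, h x ∂(M.predictor χ y n)| ≤ C := by
  have h1 := M.predictor_univ_le_one χ n y
  have : IsFiniteMeasure (M.predictor χ y n) := ⟨h1.trans_lt ENNReal.one_lt_top⟩
  refine (norm_integral_le_of_norm_le_const (f := h) (ae_of_all _ hC)).trans ?_
  refine mul_le_of_le_one_right hC0 ?_
  exact (ENNReal.toReal_mono ENNReal.one_ne_top h1).trans_eq ENNReal.toReal_one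

end Measurability

section JointLaw

variable {Ω : Type*} [MeasurableSpace Ω] {P : Measure Ω} [IsProbabilityMeasure P]

variable {Yobs : ℕ → Ω → Y} (hY : ∀ k, Measurable (Yobs k)) (hg : ∀ x y, 0 < M.g x y)
  (χ : Measure X) [IsProbabilityMeasure χ] {N : ℕ} [NeZero N] {ξ : ℕ → Fin N → Ω → X}

include hY in
/-- The joint law of the observations and of the particles at time `n`. -/
theorem map_obs_particles_eq_compProd (hξ : M.IsBootstrapFilter χ P Yobs N ξ) (n : ℕ) :
    P.map (fun ω => ((fun k => Yobs k ω), fun i => ξ n i ω))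
      = (P.map fun ω k => Yobs k ω) ⊗ₘ M.particleKernel hg χ N n := by
  have hYm : Measurable fun ω k => Yobs k ω := measurable_pi_lambda _ hY
  have hξm (n : ℕ) : Measurable fun ω i => ξ n i ω := measurable_pi_lambda _ (hξ.measurable n)
  have : IsProbabilityMeasure (P.map fun ω k => Yobs k ω) :=
    Measure.isProbabilityMeasure_map hYm.aemeasurable
  have hjm (n : ℕ) : Measurable fun ω => ((fun k => Yobs k ω), fun i => ξ n i ω) :=
    hYm.prodMk (hξm n)
  have hJ (n : ℕ) :
      IsProbabilityMeasure (P.map fun ω => ((fun k => Yobs k ω), fun i => ξ n i ω)) :=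
    Measure.isProbabilityMeasure_map (hjm n).aemeasurable
  -- It suffices to compare both laws on the products of a set and a box.
  have key (n : ℕ) (hbox : ∀ B : Set (ℕ → Y), MeasurableSet B → ∀ A : Fin N → Set X,
      (∀ i, MeasurableSet (A i)) →
      P ({ω | ∀ i, ξ n i ω ∈ A i} ∩ (fun ω k => Yobs k ω) ⁻¹' B)
        = ∫⁻ ω in (fun ω k => Yobs k ω) ⁻¹' B,
          M.particleKernel hg χ N n (fun k => Yobs k ω) (Set.univ.pi A) ∂P) :
      P.map (fun ω => ((fun k => Yobs k ω), fun i => ξ n i ω))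
        = (P.map fun ω k => Yobs k ω) ⊗ₘ M.particleKernel hg χ N n := by
    refine Measure.ext_prod fun {B T} hB hT => ?_
    -- With `B` fixed, both sides are finite measures on the particle space, and they agree on the
    -- π-system of boxes.
    have e1 : ((P.restrict ((fun ω k => Yobs k ω) ⁻¹' B)).map fun ω i => ξ n i ω)
        = M.particleKernel hg χ N n ∘ₘ ((P.map fun ω k => Yobs k ω).restrict B) := by
      have hbox' (A : Fin N → Set X) (hA : ∀ i, MeasurableSet (A i)) :
          ((P.restrict ((fun ω k => Yobs k ω) ⁻¹' B)).map fun ω i => ξ n i ω) (Set.univ.pi A)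
          = (M.particleKernel hg χ N n ∘ₘ ((P.map fun ω k => Yobs k ω).restrict B))
            (Set.univ.pi A) := by
        have hAm : MeasurableSet (Set.univ.pi A) := MeasurableSet.univ_pi hA
        rw [Measure.map_apply (hξm n) hAm, Measure.restrict_apply (hξm n hAm),
          Measure.bind_apply hAm (Kernel.aemeasurable _), setLIntegral_map hB
            (Kernel.measurable_coe _ hAm) hYm, ← hbox B hB A hA]
        congr 2
        ext ω
        simp
      refine ext_of_generate_finite _ generateFrom_pi.symm isPiSystem_pi ?_ ?_
      · rintro _ ⟨A, hA, rfl⟩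
        exact hbox' A fun i => hA i (Set.mem_univ i)
      · simpa using hbox' (fun _ => Set.univ) fun _ => MeasurableSet.univ
    have e2 := congrArg (fun μ : Measure (Fin N → X) => μ T) e1
    rw [Measure.map_apply (hξm n) hT, Measure.restrict_apply (hξm n hT),
      Measure.bind_apply hT (Kernel.aemeasurable _)] at e2
    rw [Measure.map_apply (hjm n) (hB.prod hT), Measure.compProd_apply_prod hB hT, ← e2]
    congr 1
    ext ω
    simp [and_comm]
  have hmY : MeasurableSpace.comap (fun ω k => Yobs k ω) inferInstance ≤ ‹MeasurableSpace Ω› :=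
    hYm.comap_le
  induction n with
  | zero =>
    refine key 0 fun B hB A hA => ?_
    have hS : MeasurableSet {ω | ∀ i, ξ 0 i ω ∈ A i} := by
      have := hξm 0 (MeasurableSet.univ_pi hA)
      convert this using 1
      ext ω; simp
    have h1 := measureReal_inter_eq_setIntegral_of_condExp hmY hS ⟨B, hB, rfl⟩ (hξ.init A hA)
    rw [setIntegral_const, smul_eq_mul, measureReal_def, measureReal_def] at h1
    simp only [measureReal_def, ← ENNReal.toReal_prod, ← ENNReal.toReal_mul] at h1
    rw [ENNReal.toReal_eq_toReal_iff' (measure_ne_top _ _) (ENNReal.mul_ne_top (measure_ne_top _ _)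
      (ENNReal.prod_ne_top fun i _ => measure_ne_top _ _))] at h1
    rw [h1]
    simp only [particleKernel_zero_apply, Measure.pi_pi, lintegral_const, Measure.restrict_apply,
      MeasurableSet.univ, Set.univ_inter]
    rw [mul_comm]
  | succ n ih =>
    refine key (n + 1) fun B hB A hA => ?_
    have hAm : MeasurableSet (Set.univ.pi A) := MeasurableSet.univ_pi hA
    have hS : MeasurableSet {ω | ∀ i, ξ (n + 1) i ω ∈ A i} := by
      convert hξm (n + 1) hAm using 1
      ext ω; simp
    have hpast : Measurable fun ω (k : Fin (n + 1)) i => ξ k i ω :=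
      measurable_pi_lambda _ fun k => hξm k
    have hD : MeasurableSet[MeasurableSpace.comap (fun ω k => Yobs k ω) inferInstance ⊔
        MeasurableSpace.comap (fun ω (k : Fin (n + 1)) i => ξ k i ω) inferInstance]
        ((fun ω k => Yobs k ω) ⁻¹' B) :=
      (le_sup_left : _ ≤ MeasurableSpace.comap (fun ω k => Yobs k ω) inferInstance ⊔
        MeasurableSpace.comap (fun ω (k : Fin (n + 1)) i => ξ k i ω) inferInstance) _ ⟨B, hB, rfl⟩
    have h1 := measureReal_inter_eq_setIntegral_of_condExp
      (sup_le hmY hpast.comap_le) hS hD (hξ.next n A hA)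
    have hmut (ω : Ω) : ∏ i, (M.mixture (Yobs n ω) fun j => ξ n j ω).real (A i)
        = (M.mutation hg N (Yobs n ω, fun j => ξ n j ω) (Set.univ.pi A)).toReal := by
      have := M.isProbabilityMeasure_mixture hg (Yobs n ω) fun j => ξ n j ω
      simp only [mutation_apply, Measure.pi_pi, ENNReal.toReal_prod, measureReal_def]
    have hmm : Measurable fun ω => M.mutation hg N (Yobs n ω, fun j => ξ n j ω) (Set.univ.pi A) :=
      (Kernel.measurable_coe _ hAm).comp ((hY n).prodMk (hξm n))
    simp_rw [hmut] at h1
    rw [integral_toReal hmm.aemeasurable (ae_of_all _ fun ω => measure_lt_top _ _),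
      measureReal_def, ENNReal.toReal_eq_toReal_iff' (measure_ne_top _ _) ?_] at h1
    swap
    · refine ((lintegral_mono fun ω => prob_le_one).trans_lt ?_).ne
      simp
    rw [h1]
    have hF : Measurable fun q : (ℕ → Y) × (Fin N → X) =>
        B.indicator (fun _ => (1 : ℝ≥0∞)) q.1 * M.mutation hg N (q.1 n, q.2) (Set.univ.pi A) :=
      ((measurable_const.indicator hB).comp measurable_fst).mul
        ((Kernel.measurable_coe _ hAm).comp (by fun_prop))
    have h2 : ∫⁻ ω in (fun ω k => Yobs k ω) ⁻¹' B,
          M.mutation hg N (Yobs n ω, fun j => ξ n j ω) (Set.univ.pi A) ∂P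
        = ∫⁻ q, B.indicator (fun _ => (1 : ℝ≥0∞)) q.1
            * M.mutation hg N (q.1 n, q.2) (Set.univ.pi A)
          ∂(P.map fun ω => ((fun k => Yobs k ω), fun i => ξ n i ω)) := by
      rw [lintegral_map hF (hjm n), ← lintegral_indicator (hYm hB)]
      refine lintegral_congr fun ω => ?_
      by_cases hω : (fun k => Yobs k ω) ∈ B
      · rw [Set.indicator_of_mem (show ω ∈ (fun ω k => Yobs k ω) ⁻¹' B from hω)]
        simp [hω]
      · rw [Set.indicator_of_notMem (show ω ∉ (fun ω k => Yobs k ω) ⁻¹' B from hω)]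
        simp [hω]
    -- The induction hypothesis is the joint law with the whole observation sequence, so the event
    -- `B` may involve future observations too.
    rw [h2, ih, Measure.lintegral_compProd hF, ← setLIntegral_map hB
      (Kernel.measurable_coe (M.particleKernel hg χ N (n + 1)) hAm) hYm, ← lintegral_indicator hB]
    refine lintegral_congr fun y => ?_
    by_cases hy : y ∈ B
    · rw [Set.indicator_of_mem hy, ← lintegral_indicator_one hAm]
      erw [M.lintegral_particleKernel_succ hg χ N n y (measurable_const.indicator hAm)]
      refine lintegral_congr fun x => ?_
      erw [lintegral_indicator_one hAm]
      simp [hy, mutation_apply]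
    · simp [hy]

include hY in
/-- The conditional expectation of a function of the first `n` observations and of the particles
at time `n`, given these observations. -/
theorem condExp_obs_particles_ae_eq (hξ : M.IsBootstrapFilter χ P Yobs N ξ) (n : ℕ)
    {F : (ℕ → Y) → (Fin N → X) → ℝ} (hF : BddMeas (Function.uncurry F))
    (hFn : ∀ y y', (∀ k < n, y k = y' k) → F y = F y') :
    P[fun ω => F (fun k => Yobs k ω) fun i => ξ n i ω |
        MeasurableSpace.comap (fun ω (k : Fin n) => Yobs k ω) inferInstance]
      =ᵐ[P] fun ω => ∫ x, F (fun k => Yobs k ω) x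
        ∂(M.particleKernel hg χ N n fun k => Yobs k ω) := by
  have hYm : Measurable fun ω k => Yobs k ω := measurable_pi_lambda _ hY
  have hYn : Measurable fun ω (k : Fin n) => Yobs k ω := measurable_pi_lambda _ fun k => hY k
  have hξm : Measurable fun ω i => ξ n i ω := measurable_pi_lambda _ (hξ.measurable n)
  have : IsProbabilityMeasure (P.map fun ω k => Yobs k ω) :=
    Measure.isProbabilityMeasure_map hYm.aemeasurable
  have hjm : Measurable fun ω => ((fun k => Yobs k ω), fun i => ξ n i ω) := hYm.prodMk hξm
  obtain ⟨ω₀⟩ : Nonempty Ω := nonempty_of_isProbabilityMeasure P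
  let Φ : (ℕ → Y) → ℝ := fun y => ∫ x, F y x ∂(M.particleKernel hg χ N n y)
  have hΦ : StronglyMeasurable Φ :=
    StronglyMeasurable.integral_kernel_prod_right hF.measurable.stronglyMeasurable
  obtain ⟨C, hC⟩ := hF.bdd
  have hΦb : BddMeas Φ :=
    ⟨hΦ.measurable, C, fun y => abs_integral_le_of_bound _ fun x => hC (y, x)⟩
  -- Extends a finite observation record to a sequence. The filler beyond time `n` is arbitrary; a
  -- value of `Yobs 0` is used because `Y` is not assumed inhabited.
  let e : (Fin n → Y) → ℕ → Y := fun z k => if hk : k < n then z ⟨k, hk⟩ else Yobs 0 ω₀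
  have he : Measurable e := by
    refine measurable_pi_lambda _ fun k => ?_
    by_cases hk : k < n
    · simpa [e, hk] using measurable_pi_apply _
    · simp [e, hk]
  have hΦe (y : ℕ → Y) : Φ y = Φ (e fun k => y k) := by
    have h1 : ∀ k < n, y k = e (fun k : Fin n => y k) k := fun k hk => by simp [e, hk]
    simp only [Φ]
    rw [M.particleKernel_congr hg χ N n h1, hFn _ _ h1]
  refine (ae_eq_condExp_of_forall_setIntegral_eq hYn.comap_le ?_ ?_ ?_ ?_).symm
  · exact Integrable.of_bound (hF.measurable.comp hjm).aestronglyMeasurable C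
      (ae_of_all _ fun ω => hC ((fun k => Yobs k ω), fun i => ξ n i ω))
  · intro s _ _
    exact (Integrable.of_bound (hΦ.measurable.comp hYm).aestronglyMeasurable _
      (ae_of_all _ fun ω => hΦb.bdd.choose_spec _)).integrableOn
  · rintro _ ⟨B, hB, rfl⟩ _
    set B' : Set (ℕ → Y) := (fun (y : ℕ → Y) (k : Fin n) => y k) ⁻¹' B with hB'
    have hB'm : MeasurableSet B' := (by fun_prop : Measurable fun (y : ℕ → Y) (k : Fin n) => y k) hB
    have h1 : (fun ω (k : Fin n) => Yobs k ω) ⁻¹' B = (fun ω k => Yobs k ω) ⁻¹' B' := rfl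
    have h2 : (fun ω (k : Fin n) => Yobs k ω) ⁻¹' B
        = (fun ω => ((fun k => Yobs k ω), fun i => ξ n i ω)) ⁻¹' (B' ×ˢ Set.univ) := by
      ext ω; simp [hB']
    have h3 := setIntegral_map (μ := P) hB'm hΦ.aestronglyMeasurable hYm.aemeasurable
    have h4 := setIntegral_map (μ := P) (hB'm.prod MeasurableSet.univ)
      hF.measurable.aestronglyMeasurable hjm.aemeasurable
    rw [M.map_obs_particles_eq_compProd hY hg χ hξ n,
      Measure.setIntegral_compProd hB'm MeasurableSet.univ (hF.integrable _).integrableOn] at h4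
    simp only [Measure.restrict_univ] at h4
    rw [← h2] at h4
    rw [← h1] at h3
    exact h3.symm.trans h4
  · refine Measurable.aestronglyMeasurable ?_
    have h1 : (fun ω => ∫ x, F (fun k => Yobs k ω) x
        ∂(M.particleKernel hg χ N n fun k => Yobs k ω))
        = (fun z => Φ (e z)) ∘ fun ω (k : Fin n) => Yobs k ω := by
      ext ω
      exact hΦe fun k => Yobs k ω
    rw [h1]
    exact (hΦ.measurable.comp he).comp (comap_measurable _)

end JointLaw

end HMM

/-! ### Almost sure boundedness of the likelihoods. -/

lemma IsStationarySeq.map_eq {Ω Y : Type*} [MeasurableSpace Ω] [MeasurableSpace Y] {P : Measure Ω}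
    {Yobs : ℕ → Ω → Y} (hstat : IsStationarySeq P Yobs) (hY : ∀ k, Measurable (Yobs k)) (k : ℕ) :
    P.map (Yobs k) = P.map (Yobs 0) := by
  induction k with
  | zero => rfl
  | succ k ih =>
    have h1 := congrArg (Measure.map fun y : ℕ → Y => y k) hstat
    rw [Measure.map_map (by fun_prop) (measurable_pi_lambda _ fun k => hY (k + 1)),
      Measure.map_map (by fun_prop) (measurable_pi_lambda _ hY)] at h1
    exact h1.trans ih

/-- Under the likelihood condition, the local likelihoods are almost surely bounded. -/
lemma HMM.LikelihoodCondition.ae_bounded {X Y Ω : Type*} [MeasurableSpace X] [MeasurableSpace Y]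
    [MeasurableSpace Ω] {M : HMM X Y} {P : Measure Ω} {Yobs : ℕ → Ω → Y}
    (hM : M.LikelihoodCondition P Yobs) (hY : ∀ k, Measurable (Yobs k))
    (hstat : IsStationarySeq P Yobs) :
    ∀ᵐ ω ∂P, ∀ k, ∃ B, ∀ x, M.g x (Yobs k ω) ≤ B := by
  have hm : AEMeasurable (fun y => (ENNReal.log (M.likSup y)).toENNReal) (P.map (Yobs 0)) :=
    measurable_ereal_toENNReal.comp_aemeasurable
      (ENNReal.measurable_log.comp_aemeasurable hM.aemeasurable_likSup)
  have h0 : ∀ᵐ y ∂(P.map (Yobs 0)), M.likSup y < ∞ := by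
    have h1 := hM.integrable_log
    rw [← lintegral_map' hm (hY 0).aemeasurable] at h1
    -- A finite integral forces an almost surely finite positive part of the logarithm, which
    -- excludes `likSup y = ∞`.
    filter_upwards [ae_lt_top' hm h1.ne] with y hy
    refine lt_top_iff_ne_top.2 fun htop => ?_
    rw [htop] at hy
    simp at hy
  rw [ae_all_iff]
  intro k
  rw [← hstat.map_eq hY k] at h0
  filter_upwards [ae_of_ae_map (hY k).aemeasurable h0] with ω hω
  refine ⟨(M.likSup (Yobs k ω)).toReal, fun x => ?_⟩
  rw [← ENNReal.ofReal_le_iff_le_toReal hω.ne]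
  exact le_iSup (fun x => ENNReal.ofReal (M.g x (Yobs k ω))) x

end

/-! ### The theorem for random observations. -/

theorem mainTheorem3 {X Y Ω : Type*} [MeasurableSpace X] [MeasurableSpace Y] [MeasurableSpace Ω]
    (M : HMM X Y) (P : Measure Ω) [IsProbabilityMeasure P]
    (Yobs : ℕ → Ω → Y) (hY : ∀ k, Measurable (Yobs k)) (hstat : IsStationarySeq P Yobs)
    (hM : M.LikelihoodCondition P Yobs)
    (h : X → ℝ) (hmeas : Measurable h) (hbdd : ∃ C, ∀ x, |h x| ≤ C)
    (p : ℝ) (hp : 0 < p)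
    (χ : Measure X) [IsProbabilityMeasure χ]
    (ξ : (N : ℕ) → ℕ → Fin N → Ω → X)
    (hξ : ∀ N, 1 ≤ N → M.IsBootstrapFilter χ P Yobs N (ξ N))
    (n : ℕ) :
    ∀ᵐ ω ∂P,
      Tendsto
        (fun N : ℕ => √(N : ℝ) *
          ((P[fun ω' => |empMean h (fun i => ξ N n i ω')
                - ∫ x, h x ∂(M.predictor χ (fun k => Yobs k ω') n)| ^ p |
              MeasurableSpace.comap (fun ω' (k : Fin n) => Yobs k ω') inferInstance]) ω)
            ^ (1 / p))
        atTop
        (𝓝 (√2 * M.asympStd χ (fun k => Yobs k ω) n h *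
          (Real.Gamma ((p + 1) / 2) / √Real.pi) ^ (1 / p))) ∧
      √2 * M.asympStd χ (fun k => Yobs k ω) n h *
          (Real.Gamma ((p + 1) / 2) / √Real.pi) ^ (1 / p) =
        (∫ z, |M.asympStd χ (fun k => Yobs k ω) n h * z| ^ p ∂(gaussianReal 0 1)) ^ (1 / p) := by
  have hh : BddMeas h := ⟨hmeas, hbdd⟩
  obtain ⟨C, hC0, hC⟩ := hh.exists_bound
  have hg := hM.g_pos
  -- The filter is assumed only for `N ≥ 1`, so everything is indexed by `N + 1`. Almost sure
  -- identities for countably many `N` then hold simultaneously.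
  have hcond (N : ℕ) := M.condExp_obs_particles_ae_eq hY hg χ (hξ (N + 1) (by omega)) n
    (F := fun y x => |empMean h x - ∫ z, h z ∂(M.predictor χ y n)| ^ p)
    ⟨by
      have h1 : Measurable fun q : (ℕ → Y) × (Fin (N + 1) → X) =>
          ∫ z, h z ∂(M.predictor χ q.1 n) :=
        (M.measurable_integral_predictor χ n hmeas).comp measurable_fst
      have h2 : Measurable fun q : (ℕ → Y) × (Fin (N + 1) → X) => empMean h q.2 := by
        unfold empMean
        fun_prop
      exact (h2.sub h1).abs.pow_const p,
    (2 * C) ^ p, fun q => by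
      rw [Function.uncurry, abs_of_nonneg (Real.rpow_nonneg (abs_nonneg _) _)]
      refine Real.rpow_le_rpow (abs_nonneg _) ((abs_sub _ _).trans ?_) hp.le
      linarith [abs_empMean_le hC q.2, M.abs_integral_predictor_le χ n q.1 hC0 hC]⟩
    fun y y' hy => by rw [M.predictor_congr χ n hy]
  filter_upwards [hM.ae_bounded hY hstat, ae_all_iff.2 hcond] with ω hb hω
  refine ⟨?_, integral_abs_mul_rpow_gaussianReal (Real.sqrt_nonneg _) hp⟩
  rw [← tendsto_add_atTop_iff_nat 1]
  refine (M.tendsto_sqrt_mul_integral_rpow hb hg χ n hh hp).congr fun N => ?_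
  rw [hω N]
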